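/- Let $S=\mathbb{C}[x,y,z]$ and $\mathfrak m=(x,y,z)$. For a reduced curve $C:f=0$ of degree $d$ in $\mathbb{P}^2$ ($f\in S$ homogeneous of degree $d$ without multiple factors), let $J_f=(f_x,f_y,f_z)$ be the Jacobian ideal, $I_f$ its saturation with respect to $\mathfrak m$, $N(f)=I_f/J_f$, $n(f)_j=\dim N(f)_j$ and $\nu(C)=\max_j n(f)_j$. Let $mdr(f)$ be the least $m\ge 0$ for which there is a nonzero triple $(a,b,c)$ of homogeneous polynomials of degree $m$ with $af_x+bf_y+cf_z=0$. The curve $C$ is free with exponents $(d_1,d_2)$ if $J_f=I_f$, $d_1=mdr(f)$ and $d_2=d-1-d_1$; it is nearly free with exponents $(d_1,d_2)$ if $\nu(C)=1$, $d_1=mdr(f)$ and $d_2=d-d_1$. Consider the tricuspidal quartic $\mathcal C_4$ and the rational cuspidal quintics $\mathcal C_5,\mathcal C_5',\mathcal C_5''$ in $\mathbb{P}^2$ which are the images of $\mathbb{P}^1$ under the parametrizations $$\mathcal C_4:\ (s:t)\mapsto(s^3t-\tfrac12 s^4:\ s^2t^2:\ t^4-2st^3),$$ $$\mathcal C_5:\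 (s:t)\mapsto(s^4t-\tfrac12 s^5:\ s^3t^2:\ -\tfrac32 st^4+t^5),$$ $$\mathcal C_5':\ (s:t)\mapsto(s^4t-s^5:\ s^2t^3-\tfrac5{32}s^5:\ -\tfrac{125}{128}s^5-\tfrac{25}{16}s^3t^2-5st^4+t^5),$$ $$\mathcal C_5'':\ (s:t)\mapsto(s^4t:\ s^2t^3-s^5:\ t^5+2s^3t^2).$$ Then $\mathcal C_4$ is nearly free with exponents $(2,2)$, and $\mathcal C_5$, $\mathcal C_5'$ and $\mathcal C_5''$ are free with exponents $(2,2)$. Moreover, after a projective linear change of coordinates, $\mathcal C_4$ becomes the reduced curve $$x^2y^2+y^2z^2+x^2z^2-2xyz(x+y+z)=0,$$ which is likewise nearly free with exponents $(2,2)$, and in the given coordinates $\mathcal C_5$ and $\mathcal C_5''$ have the reduced equations $$\mathcal C_5:\ 9xy^4-4y^5-24x^2y^2z+48xy^3z-16y^4z+16x^3z^2=0,$$ $$\mathcal C_5'':\ -27x^5+2x^2y^3-18x^3yz+y^4z-2xy^2z^2+x^2z^3=0.$$ -/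

import Mathlib

namespace PlaneCurve

/-- The polynomial ring `S = ℂ[x, y, z]`, with `x = X 0`, `y = X 1`, `z = X 2`. -/
abbrev S : Type := MvPolynomial (Fin 3) ℂ

/-- The complex projective plane. -/
abbrev P2 : Type := Projectivization ℂ (Fin 3 → ℂ)

section Jacobian

/-- The partial derivatives `f_x, f_y, f_z`. -/
noncomputable def grad (f : S) (i : Fin 3) : S := MvPolynomial.pderiv i f

/-- The Jacobian ideal `J_f = (f_x, f_y, f_z)`. -/
noncomputable def jacobianIdeal (f : S) : Ideal S := Ideal.span (Set.range (grad f))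

/-- The maximal ideal `𝔪 = (x, y, z)`. -/
noncomputable def irrelevantIdeal : Ideal S :=
  Ideal.span (Set.range (MvPolynomial.X : Fin 3 → S))

/-- The saturation `{g | 𝔪 ^ k g ⊆ J for some k}` of an ideal `J` with respect to `𝔪`. -/
noncomputable def saturation (J : Ideal S) : Ideal S where
  carrier := {g | ∃ k : ℕ, ∀ h ∈ irrelevantIdeal ^ k, h * g ∈ J}
  zero_mem' := ⟨0, fun h _ => by simp⟩
  add_mem' := by
    rintro a b ⟨k, hk⟩ ⟨l, hl⟩
    refine ⟨max k l, fun h hh => ?_⟩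
    rw [mul_add]
    exact J.add_mem (hk h (Ideal.pow_le_pow_right (le_max_left k l) hh))
      (hl h (Ideal.pow_le_pow_right (le_max_right k l) hh))
  smul_mem' := by
    rintro c a ⟨k, hk⟩
    refine ⟨k, fun h hh => ?_⟩
    rw [smul_eq_mul, mul_left_comm]
    exact J.mul_mem_left c (hk h hh)

/-- The graded piece `N(f)_j` of the Jacobian module `N(f) = I_f / J_f`, where `I_f` is the
saturation of `J_f`, realized inside the Milnor algebra `M(f) = S / J_f`. -/
noncomputable def jacobianModulePiece (f : S) (j : ℕ) : Submodule ℂ (S ⧸ jacobianIdeal f) :=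
  Submodule.map (Ideal.Quotient.mkₐ ℂ (jacobianIdeal f)).toLinearMap
    ((saturation (jacobianIdeal f)).restrictScalars ℂ ⊓
      MvPolynomial.homogeneousSubmodule (Fin 3) ℂ j)

/-- `n(f)_j = dim N(f)_j`. -/
noncomputable def nDim (f : S) (j : ℕ) : ℕ := Module.finrank ℂ (jacobianModulePiece f j)

/-- `ν = max_j n(f)_j`. -/
noncomputable def nu (f : S) : ℕ∞ := ⨆ j : ℕ, (nDim f j : ℕ∞)

/-- The module `AR(f)` of all Jacobian relations `a f_x + b f_y + c f_z = 0`. -/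
noncomputable def jacobianRelations (f : S) : Submodule S (Fin 3 → S) :=
  LinearMap.ker (Fintype.linearCombination S (grad f))

/-- `AR(f)_k`: the relations whose three entries are homogeneous of degree `k`. -/
noncomputable def jacobianRelationsPiece (f : S) (k : ℕ) : Submodule ℂ (Fin 3 → S) :=
  (jacobianRelations f).restrictScalars ℂ ⊓
    Submodule.pi Set.univ (fun _ => MvPolynomial.homogeneousSubmodule (Fin 3) ℂ k)

/-- `ar(f)_k = dim AR(f)_k`. -/
noncomputable def arDim (f : S) (k : ℕ) : ℕ := Module.finrank ℂ (jacobianRelationsPiece f k)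

/-- `mdr(f)`: the smallest `m` with `ar(f)_m > 0`. -/
noncomputable def mdr (f : S) : ℕ := sInf {m : ℕ | 0 < arDim f m}

end Jacobian

section Curves

/-- The zero set in the projective plane of a (homogeneous) polynomial. -/
def zeroSet (f : S) : Set P2 := {p | MvPolynomial.eval p.rep f = 0}

/-- `C : f = 0` is a reduced plane curve of degree `d`: `f` is homogeneous of degree `d`, has no
multiple factors, and its zero set is `C`. -/
structure IsReducedEquation (C : Set P2) (d : ℕ) (f : S) : Prop where
  isHomogeneous : f.IsHomogeneous d
  squarefree : Squarefree f
  zeroSet_eq : zeroSet f = C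

/-- `C : f = 0` is a free curve with exponents `(d₁, d₂)`: one has `J_f = I_f`, `d₁ = mdr(f)` and
`d₂ = d - 1 - d₁`. The reduced equation `f` of `C` is unique up to a nonzero constant factor. -/
def IsFreeWithExponents (C : Set P2) (d₁ d₂ : ℕ) : Prop :=
  ∃ (d : ℕ) (f : S), IsReducedEquation C d f ∧
    saturation (jacobianIdeal f) = jacobianIdeal f ∧ mdr f = d₁ ∧ d₁ + d₂ + 1 = d

/-- `C : f = 0` is a nearly free curve with exponents `(d₁, d₂)`: one has `ν = 1`, `d₁ = mdr(f)`
and `d₂ = d - d₁`. The reduced equation `f` of `C` is unique up to a nonzero constant factor. -/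
def IsNearlyFreeWithExponents (C : Set P2) (d₁ d₂ : ℕ) : Prop :=
  ∃ (d : ℕ) (f : S), IsReducedEquation C d f ∧ nu f = 1 ∧ mdr f = d₁ ∧ d₁ + d₂ = d

/-- Projective equivalence: some projective linear automorphism of the plane maps `C` onto `D`. -/
def ProjectivelyEquivalent (C D : Set P2) : Prop :=
  ∃ e : (Fin 3 → ℂ) ≃ₗ[ℂ] (Fin 3 → ℂ),
    Projectivization.map e.toLinearMap e.injective '' C = D

/-- The set of all points `φ(s, t)` of the plane. (For the parametrizations below, `φ(s, t)` is
zero only for `s = t = 0`.) -/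
def parametrized (φ : ℂ → ℂ → Fin 3 → ℂ) : Set P2 :=
  {p | ∃ (s t : ℂ) (h : φ s t ≠ 0), p = Projectivization.mk ℂ (φ s t) h}

/-- The tricuspidal quartic `𝒞₄`. -/
noncomputable def quartic : Set P2 :=
  parametrized fun s t =>
    ![s ^ 3 * t - 1 / 2 * s ^ 4, s ^ 2 * t ^ 2, t ^ 4 - 2 * s * t ^ 3]

/-- The quintic `𝒞₅`, with cusps of types `E₆, A₄, A₂`. -/
noncomputable def quintic : Set P2 :=
  parametrized fun s t =>
    ![s ^ 4 * t - 1 / 2 * s ^ 5, s ^ 3 * t ^ 2, -(3 / 2) * s * t ^ 4 + t ^ 5]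

/-- The quintic `𝒞₅'`, with three cusps of type `A₄`. -/
noncomputable def quintic' : Set P2 :=
  parametrized fun s t =>
    ![s ^ 4 * t - s ^ 5,
      s ^ 2 * t ^ 3 - 5 / 32 * s ^ 5,
      -(125 / 128) * s ^ 5 - 25 / 16 * s ^ 3 * t ^ 2 - 5 * s * t ^ 4 + t ^ 5]

/-- The quintic `𝒞₅''`, with cusps of types `A₆, A₂, A₂, A₂`. -/
noncomputable def quintic'' : Set P2 :=
  parametrized fun s t =>
    ![s ^ 4 * t, s ^ 2 * t ^ 3 - s ^ 5, t ^ 5 + 2 * s ^ 3 * t ^ 2]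

end Curves

section Equations

open MvPolynomial

/-- `x²y² + y²z² + x²z² - 2xyz(x + y + z)` -/
noncomputable def quarticEq : S :=
  X 0 ^ 2 * X 1 ^ 2 + X 1 ^ 2 * X 2 ^ 2 + X 0 ^ 2 * X 2 ^ 2
    - 2 * X 0 * X 1 * X 2 * (X 0 + X 1 + X 2)

/-- `9xy⁴ - 4y⁵ - 24x²y²z + 48xy³z - 16y⁴z + 16x³z²` -/
noncomputable def quinticEq : S :=
  9 * X 0 * X 1 ^ 4 - 4 * X 1 ^ 5 - 24 * X 0 ^ 2 * X 1 ^ 2 * X 2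
    + 48 * X 0 * X 1 ^ 3 * X 2 - 16 * X 1 ^ 4 * X 2 + 16 * X 0 ^ 3 * X 2 ^ 2

/-- `-27x⁵ + 2x²y³ - 18x³yz + y⁴z - 2xy²z² + x²z³` -/
noncomputable def quinticEq'' : S :=
  -27 * X 0 ^ 5 + 2 * X 0 ^ 2 * X 1 ^ 3 - 18 * X 0 ^ 3 * X 1 * X 2
    + X 1 ^ 4 * X 2 - 2 * X 0 * X 1 ^ 2 * X 2 ^ 2 + X 0 ^ 2 * X 2 ^ 3

end Equations

end PlaneCurve

/-! Everything rests on the Hilbert–Burch theorem (`exists_mulVec_eq`): if polynomials D_i without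
common divisor are, up to units, the maximal minors of an (n+1)×n matrix M over a UFD, and the
columns of M are syzygies of the D_i, then these columns generate all syzygies. If moreover some D_i
is nonzero at a point P of the plane, the ideal (D_i) is saturated (`mem_span_of_mul_mem`,
`saturation_span_eq`): two linear forms vanishing at P suffice to test this.

For each quintic the partial derivatives are the minors of a 3×2 matrix of quadratic forms. So J_f
is saturated and every Jacobian relation has order at least 2, which gives mdr = 2. For each quartic
the partials and one further cubic h are the minors of a 4×3 matrix of linear forms with last row
(x, y, z). So I_f = (J_f, h), 𝔪h ⊆ J_f and h ∉ J_f, and N(f) is a line in degree 3. A relation among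
the partials is given by M b with x b_0 + y b_1 + z b_2 = 0; this forces b to have no constant term,
and again the order is at least 2.

Coprimality of the partials is checked on a line missing their common zeros; it also makes f
squarefree. Parametrizations of the quintics are matched with equations by elimination: for x = 1
the parameter is a root of a quadratic or cubic over ℂ[y], z is a polynomial in it, and f is a
constant times the norm of the difference. The quartic is the locus ±√(xy) ± √(yz) ± √(xz) = 0. -/

namespace PlaneCurve

open MvPolynomial

/-! ### Syzygies of maximal minors -/

section HilbertBurch

variable {R : Type*} [CommRing R]

/-- `d i` divides every `a i * d k`, hence their gcd over k, which is `a i` up to a unit. -/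
lemma dvd_of_forall_mul_eq_mul [IsDomain R] [UniqueFactorizationMonoid R] {ι : Type*} [Fintype ι]
    {d a : ι → R} (hd : ∀ g, (∀ i, g ∣ d i) → IsUnit g)
    (h : ∀ i k, d k * a i = d i * a k) (i : ι) : d i ∣ a i := by
  classical
  let := (inferInstance : Nonempty (NormalizationMonoid R)).some
  let := UniqueFactorizationMonoid.toNormalizedGCDMonoid R
  have h1 : d i ∣ Finset.univ.gcd fun k => a i * d k :=
    Finset.dvd_gcd fun k _ => ⟨a k, by rw [mul_comm, h]⟩
  have h2 : IsUnit (Finset.univ.gcd d) := hd _ fun k => Finset.gcd_dvd (Finset.mem_univ k)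
  exact h2.dvd_mul_right.1 (h1.trans (Finset.gcd_mul_left' _ d (a i)).dvd)

variable {n : ℕ} (M : Matrix (Fin (n + 1)) (Fin n) R)

/-- The maximal minor of `M` that omits row `i`. -/
def rowMinor (i : Fin (n + 1)) : R := (M.submatrix i.succAbove id).det

lemma adjugate_mulVec_mulVec (i : Fin (n + 1)) (b : Fin n → R) :
    (M.submatrix i.succAbove id).adjugate.mulVec (fun j => M.mulVec b (i.succAbove j)) =
      rowMinor M i • b := by
  have : (fun j => M.mulVec b (i.succAbove j)) = (M.submatrix i.succAbove id).mulVec b := rfl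
  rw [this, Matrix.mulVec_mulVec, Matrix.adjugate_mul, Matrix.smul_mulVec, Matrix.one_mulVec]
  rfl

/-- Cramer's rule: M is injective wherever some maximal minor survives. It serves with ψ the
identity and with ψ the restriction to a line through the origin. -/
lemma map_eq_zero_of_map_mulVec_eq_zero {T : Type*} [CommRing T] [IsDomain T] (ψ : R →+* T)
    {i : Fin (n + 1)} (hi : ψ (rowMinor M i) ≠ 0) {b : Fin n → R}
    (hb : ∀ j, ψ (M.mulVec b j) = 0) (l : Fin n) : ψ (b l) = 0 := by
  have h := congrArg ψ (congrFun (adjugate_mulVec_mulVec M i b) l)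
  have h0 : ψ ((M.submatrix i.succAbove id).adjugate.mulVec
      (fun j => M.mulVec b (i.succAbove j)) l) = 0 := by
    simp only [Matrix.mulVec, dotProduct, map_sum, map_mul]
    refine Finset.sum_eq_zero fun j _ => ?_
    have := hb (i.succAbove j)
    simp only [Matrix.mulVec, dotProduct, map_sum, map_mul] at this
    rw [this, mul_zero]
  rw [h0, Pi.smul_apply, smul_eq_mul, map_mul] at h
  exact (mul_eq_zero.1 h.symm).resolve_left hi

variable {M} {D : Fin (n + 1) → R} {u : Fin (n + 1) → R}

/-- Cramer's rule solves every row except i. Row i then follows because D annihilates both a and the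
columns of M, and `D i ≠ 0`. -/
lemma exists_mulVec_eq_rowMinor_smul [IsDomain R] (hM : ∀ i, rowMinor M i = u i * D i)
    (hD : ∀ l, ∑ i, D i * M i l = 0) {a : Fin (n + 1) → R} (ha : ∑ i, D i * a i = 0)
    (i : Fin (n + 1)) : ∃ b, M.mulVec b = rowMinor M i • a := by
  by_cases hi : rowMinor M i = 0
  · exact ⟨0, by simp [hi]⟩
  refine ⟨(M.submatrix i.succAbove id).adjugate.mulVec (fun j => a (i.succAbove j)), ?_⟩
  set b := (M.submatrix i.succAbove id).adjugate.mulVec (fun j => a (i.succAbove j)) with hb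
  have hoff : ∀ j, M.mulVec b (i.succAbove j) = rowMinor M i * a (i.succAbove j) := by
    intro j
    have : (M.submatrix i.succAbove id).mulVec b = rowMinor M i • fun j => a (i.succAbove j) := by
      rw [hb, Matrix.mulVec_mulVec, Matrix.mul_adjugate, Matrix.smul_mulVec, Matrix.one_mulVec]
      rfl
    exact congrFun this j
  have hDi : D i ≠ 0 := fun h => hi (by rw [hM, h, mul_zero])
  have hsum : ∑ j, D j * M.mulVec b j = 0 := by
    simp only [Matrix.mulVec, dotProduct, Finset.mul_sum]
    rw [Finset.sum_comm]
    refine Finset.sum_eq_zero fun l _ => ?_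
    simp only [← mul_assoc]
    rw [← Finset.sum_mul, hD, zero_mul]
  rw [Fin.sum_univ_succAbove _ i] at hsum ha
  have hi' : M.mulVec b i = rowMinor M i * a i := by
    refine mul_left_cancel₀ hDi ?_
    have h1 : ∑ j, D (i.succAbove j) * M.mulVec b (i.succAbove j) =
        rowMinor M i * ∑ j, D (i.succAbove j) * a (i.succAbove j) := by
      rw [Finset.mul_sum]
      exact Finset.sum_congr rfl fun j _ => by rw [hoff]; ring
    rw [h1] at hsum
    linear_combination hsum - rowMinor M i * ha
  ext j
  rcases Fin.eq_self_or_eq_succAbove i j with rfl | ⟨k, rfl⟩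
  · exact hi'
  · exact hoff k

/-- The Hilbert–Burch theorem: the syzygies of the maximal minors, if these have no common
divisor, are the combinations of the columns. -/
lemma exists_mulVec_eq [IsDomain R] [UniqueFactorizationMonoid R] (hM : ∀ i, rowMinor M i = u i * D i)
    (hu : ∀ i, IsUnit (u i)) (hD : ∀ l, ∑ i, D i * M i l = 0)
    (hgcd : ∀ g, (∀ i, g ∣ D i) → IsUnit g) {a : Fin (n + 1) → R} (ha : ∑ i, D i * a i = 0) :
    ∃ b, M.mulVec b = a := by
  choose b hb using exists_mulVec_eq_rowMinor_smul hM hD ha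
  have hgcd' : ∀ g, (∀ i, g ∣ rowMinor M i) → IsUnit g := fun g hg =>
    hgcd g fun i => (hu i).dvd_mul_left.1 (hM i ▸ hg i)
  obtain ⟨i, hi⟩ : ∃ i, rowMinor M i ≠ 0 := by
    by_contra! h
    exact not_isUnit_zero (hgcd' 0 fun i => (h i).symm ▸ dvd_rfl)
  -- Injectivity of M gives m_k b_j = m_j b_k for the minors m, so by coprimality each solution is
  -- divisible by its own minor.
  have hdvd : ∀ l, rowMinor M i ∣ b i l := by
    intro l
    refine dvd_of_forall_mul_eq_mul (d := rowMinor M) (a := fun k => b k l) hgcd'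
      (fun j k => ?_) i
    have h0 : M.mulVec (rowMinor M k • b j - rowMinor M j • b k) = 0 := by
      rw [Matrix.mulVec_sub, Matrix.mulVec_smul, Matrix.mulVec_smul, hb, hb, smul_comm, sub_self]
    have := map_eq_zero_of_map_mulVec_eq_zero M (RingHom.id R) hi
      (fun j => by rw [h0]; rfl) l
    exact sub_eq_zero.1 this
  choose c hc using hdvd
  refine ⟨c, ?_⟩
  have : rowMinor M i • M.mulVec c = rowMinor M i • a := by
    rw [← hb, ← Matrix.mulVec_smul]
    congr 1
    ext l
    exact (hc l).symm
  exact smul_right_injective _ hi this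

/-- The ideal of maximal minors is saturated with respect to a pair `p, q` cutting out a point
at which some minor does not vanish. -/
lemma mem_span_of_mul_mem [IsDomain R] [UniqueFactorizationMonoid R] (hM : ∀ i, rowMinor M i = u i * D i)
    (hu : ∀ i, IsUnit (u i)) (hD : ∀ l, ∑ i, D i * M i l = 0)
    (hgcd : ∀ g, (∀ i, g ∣ D i) → IsUnit g) {p q : R} (hp : Prime p) (hpq : ¬ p ∣ q)
    {T : Type*} [CommRing T] [IsDomain T] (ψ : R →+* T) (hψp : ψ p = 0) (hψq : ψ q = 0)
    (hψ : ∀ g, ψ g = 0 → g ∈ Ideal.span {p, q}) {i : Fin (n + 1)} (hi : ψ (rowMinor M i) ≠ 0)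
    {g : R} (hpg : p * g ∈ Ideal.span (Set.range D)) (hqg : q * g ∈ Ideal.span (Set.range D)) :
    g ∈ Ideal.span (Set.range D) := by
  obtain ⟨a, ha⟩ := (Ideal.mem_span_range_iff_exists_fun).1 hpg
  obtain ⟨b, hb⟩ := (Ideal.mem_span_range_iff_exists_fun).1 hqg
  obtain ⟨c, hc⟩ := exists_mulVec_eq hM hu hD hgcd (a := fun i => q * a i - p * b i) (by
    have : ∀ i, D i * (q * a i - p * b i) = q * (a i * D i) - p * (b i * D i) := fun i => by ring
    rw [Finset.sum_congr rfl fun i _ => this i, Finset.sum_sub_distrib, ← Finset.mul_sum,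
      ← Finset.mul_sum, ha, hb]
    ring)
  -- Modulo (p, q) the vector M c = q a - p b vanishes while M stays injective.
  have hc0 : ∀ l, c l ∈ Ideal.span {p, q} := fun l => hψ _ <|
    map_eq_zero_of_map_mulVec_eq_zero M ψ hi (fun j => by rw [hc]; simp [hψp, hψq]) l
  simp only [Ideal.mem_span_pair] at hc0
  choose v w hvw using hc0
  have hc' : c = p • v + q • w := by
    ext l; simp [← hvw, mul_comm]
  have hrow : ∀ j, p * M.mulVec v j + q * M.mulVec w j = q * a j - p * b j := by
    intro j
    rw [← congrFun hc j, hc', Matrix.mulVec_add, Matrix.mulVec_smul, Matrix.mulVec_smul]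
    rfl
  -- This is q (a - M w) = p (b + M v). The quotient of a - M w by p expresses g, since M w is a
  -- syzygy.
  have hdvd : ∀ j, p ∣ a j - M.mulVec w j := fun j =>
    (hp.dvd_or_dvd (a := q) ⟨b j + M.mulVec v j, by linear_combination - hrow j⟩).resolve_left hpq
  choose e he using hdvd
  refine (Ideal.mem_span_range_iff_exists_fun).2 ⟨e, mul_left_cancel₀ hp.ne_zero ?_⟩
  have hw : ∑ j, M.mulVec w j * D j = 0 := by
    simp only [Matrix.mulVec, dotProduct, Finset.sum_mul]
    rw [Finset.sum_comm]
    refine Finset.sum_eq_zero fun l _ => ?_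
    rw [← mul_zero (w l), ← hD l, Finset.mul_sum]
    exact Finset.sum_congr rfl fun j _ => by ring
  calc p * ∑ j, e j * D j = ∑ j, (a j * D j - M.mulVec w j * D j) := by
        rw [Finset.mul_sum]
        exact Finset.sum_congr rfl fun j _ => by linear_combination - D j * he j
    _ = p * g := by rw [Finset.sum_sub_distrib, ha, hw, sub_zero]

end HilbertBurch

/-! ### Saturation with respect to 𝔪 -/

section Saturation

lemma le_saturation (J : Ideal S) : J ≤ saturation J :=
  fun _ hg => ⟨0, fun h _ => J.mul_mem_left h hg⟩

lemma saturation_mono {J K : Ideal S} (hJK : J ≤ K) : saturation J ≤ saturation K :=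
  fun _ ⟨k, hk⟩ => ⟨k, fun h hh => hJK (hk h hh)⟩

lemma saturation_eq_self {J : Ideal S} (hJ : ∀ g, (∀ m, X m * g ∈ J) → g ∈ J) :
    saturation J = J := by
  refine le_antisymm ?_ (le_saturation J)
  rintro g ⟨k, hk⟩
  induction k with
  | zero => simpa using hk 1 (by simp)
  | succ k ih =>
    refine ih fun h hh => hJ _ fun m => ?_
    rw [← mul_assoc]
    refine hk _ ?_
    rw [pow_succ']
    exact Ideal.mul_mem_mul (Ideal.subset_span ⟨m, rfl⟩) hh

lemma sub_algHom_mem {I : Ideal S} (ψ : S →ₐ[ℂ] S) (hψ : ∀ m, X m - ψ (X m) ∈ I) (g : S) :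
    g - ψ g ∈ I := by
  have : (Ideal.Quotient.mkₐ ℂ I).comp ψ = Ideal.Quotient.mkₐ ℂ I :=
    MvPolynomial.algHom_ext fun m => (Ideal.Quotient.eq.2 (hψ m)).symm
  exact Ideal.Quotient.eq.1 (DFunLike.congr_fun this g).symm

lemma sub_C_mem_irrelevantIdeal (g : S) : g - C (eval 0 g) ∈ irrelevantIdeal := by
  have := sub_algHom_mem (I := irrelevantIdeal) (aeval 0)
    (fun m => by
      rw [aeval_X, Pi.zero_apply, sub_zero]; exact Ideal.subset_span ⟨m, rfl⟩) g
  rwa [show aeval (0 : Fin 3 → S) g = C (eval 0 g) by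
    rw [show (0 : Fin 3 → S) = fun m => C ((0 : Fin 3 → ℂ) m) by ext; simp]
    exact aeval_algebraMap_apply S (0 : Fin 3 → ℂ) g] at this

variable {n : ℕ} {M : Matrix (Fin (n + 1)) (Fin n) S} {D u : Fin (n + 1) → S}

/-- The ideal of maximal minors without common divisor is saturated, if the minors do not all
vanish at a given point `P` of the plane. -/
lemma saturation_span_eq (hM : ∀ i, rowMinor M i = u i * D i) (hu : ∀ i, IsUnit (u i))
    (hD : ∀ l, ∑ i, D i * M i l = 0) (hgcd : ∀ g, (∀ i, g ∣ D i) → IsUnit g)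
    {P : Fin 3 → ℂ} {i j k : Fin 3} (hijk : ∀ m, m = i ∨ m = j ∨ m = k) (hji : j ≠ i)
    (hjk : j ≠ k) (hPi : P i = 0) (hPk : P k = 1) {r : Fin (n + 1)} (hr : eval P (D r) ≠ 0) :
    saturation (Ideal.span (Set.range D)) = Ideal.span (Set.range D) := by
  refine saturation_eq_self fun g hg => ?_
  have hpq : ¬ (X i : S) ∣ X j - C (P j) * X k := by
    intro h
    have := map_dvd (eval (Pi.single j 1 : Fin 3 → ℂ)) h
    simp [hji.symm, hjk.symm] at this
  -- Restriction to the line through the origin and P, cut out by `X i` and `X j - C (P j) * X k`;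
  -- as `P k = 1`, `X k` is a coordinate on it.
  let ψ : S →ₐ[ℂ] S := aeval fun m => C (P m) * X k
  have hψX : ∀ m, ψ (X m) = C (P m) * X k := fun m => aeval_X _ _
  have hψC : ∀ c, ψ (C c) = C c := fun c => aeval_C _ _
  have heval : ∀ g, eval P (ψ g) = eval P g := by
    have : (aeval P).comp ψ = (aeval P : S →ₐ[ℂ] ℂ) := by
      refine MvPolynomial.algHom_ext fun m => ?_
      simp [hψX, hPk]
    exact fun g => by simpa [aeval_eq_eval] using DFunLike.congr_fun this g
  have hψ : ∀ g, g - ψ g ∈ Ideal.span {X i, X j - C (P j) * X k} := by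
    refine sub_algHom_mem ψ fun m => ?_
    rw [hψX]
    rcases hijk m with rfl | rfl | rfl
    · rw [hPi]; simpa using Ideal.subset_span (by simp)
    · exact Ideal.subset_span (by simp)
    · rw [hPk]; simp
  refine mem_span_of_mul_mem hM hu hD hgcd (p := X i) (q := X j - C (P j) * X k)
    (X_prime) hpq ψ.toRingHom (i := r) ?_ ?_ ?_ ?_ (hg i) ?_
  · simp [hψX, hPi]
  · simp [hψX, hψC, hPk]
  · intro g hg
    have := hψ g
    rwa [show ψ g = 0 from hg, sub_zero] at this
  · intro h
    have h1 : eval P (ψ (u r * D r)) = 0 := by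
      rw [← hM, show ψ (rowMinor M r) = 0 from h, map_zero]
    rw [heval, map_mul] at h1
    exact hr ((mul_eq_zero.1 h1).resolve_left ((hu r).map (eval P)).ne_zero)
  · rw [sub_mul, mul_assoc]
    exact sub_mem (hg j) (Ideal.mul_mem_left _ _ (hg k))

end Saturation

/-! ### Coprimality by restriction to a line -/

section LineRestriction

lemma natDegree_aeval_le {l : Fin 3 → Polynomial ℂ} (hl : ∀ i, (l i).natDegree ≤ 1) (g : S) :
    (aeval l g).natDegree ≤ g.totalDegree := by
  rw [aeval_def, eval₂_eq']
  refine Polynomial.natDegree_sum_le_of_forall_le _ _ fun m hm => ?_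
  refine Polynomial.natDegree_mul_le.trans ?_
  rw [Polynomial.algebraMap_eq, Polynomial.natDegree_C, zero_add]
  refine (Polynomial.natDegree_prod_le _ _).trans (le_trans ?_ (le_totalDegree hm))
  rw [Finsupp.sum_fintype _ _ (fun _ => rfl)]
  refine Finset.sum_le_sum fun i _ => Polynomial.natDegree_pow_le.trans ?_
  exact (Nat.mul_le_mul_left _ (hl i)).trans (mul_one _).le

/-- If a line misses all common zeros of polynomials `D i`, these have no common divisor. -/
lemma isUnit_of_forall_dvd {ι : Type*} [Fintype ι] {D : ι → S} {l : Fin 3 → Polynomial ℂ}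
    (hl : ∀ i, (l i).natDegree ≤ 1) {v : ι → Polynomial ℂ}
    (hv : IsUnit (∑ i, v i * aeval l (D i))) {i : ι} {d : ℕ} (hi : (D i).totalDegree ≤ d)
    (hid : (aeval l (D i)).coeff d ≠ 0) {g : S} (hg : ∀ i, g ∣ D i) : IsUnit g := by
  have hgl : IsUnit (aeval l g) := isUnit_of_dvd_unit
    (Finset.dvd_sum fun i _ => (map_dvd (aeval l) (hg i)).mul_left _) hv
  obtain ⟨h, hgh⟩ := hg i
  have h0 : D i ≠ 0 := by rintro h; simp [h] at hid
  have hg0 : g ≠ 0 := by rintro rfl; simp [hgh] at h0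
  have hh0 : h ≠ 0 := by rintro rfl; simp [hgh] at h0
  -- On the line g becomes a constant while `D i` keeps degree d, so deg g + deg h ≤ d ≤ 0 + deg h
  -- and g is constant.
  have hd := Polynomial.le_natDegree_of_ne_zero hid
  rw [hgh, totalDegree_mul_of_isDomain hg0 hh0] at hi
  rw [hgh, map_mul] at hd
  have h1 := hd.trans Polynomial.natDegree_mul_le
  have h2 := natDegree_aeval_le hl h
  rw [Polynomial.natDegree_eq_zero_of_isUnit hgl] at h1
  have : g.totalDegree = 0 := by omega
  rw [totalDegree_eq_zero_iff_eq_C] at this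
  rw [this] at hg0 ⊢
  exact (isUnit_iff_ne_zero.2 fun h => hg0 (by rw [h, C_0])).map C

/-- By the product rule a repeated factor of f divides all partial derivatives. -/
lemma squarefree_of_forall_dvd_grad {f : S} (hf : ∀ g, (∀ i, g ∣ grad f i) → IsUnit g) :
    Squarefree f := by
  rintro g ⟨h, rfl⟩
  refine hf g fun i => ⟨pderiv i g * h * 2 + g * pderiv i h, ?_⟩
  simp only [grad, Derivation.leibniz, smul_eq_mul]
  ring

end LineRestriction

/-! ### Minimal degree of Jacobian relations -/

section JacobianRelations

lemma mem_jacobianRelationsPiece {f : S} {k : ℕ} {a : Fin 3 → S} :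
    a ∈ jacobianRelationsPiece f k ↔
      ∑ i, grad f i * a i = 0 ∧ ∀ i, (a i).IsHomogeneous k := by
  simp [jacobianRelationsPiece, jacobianRelations, Fintype.linearCombination_apply, mul_comm,
    Submodule.mem_pi]

lemma arDim_pos_iff {f : S} {k : ℕ} :
    0 < arDim f k ↔ ∃ a ∈ jacobianRelationsPiece f k, a ≠ 0 := by
  -- Needed because `finrank` is 0 in infinite dimension.
  have : Module.Finite ℂ (jacobianRelationsPiece f k) := by
    have : Module.Finite ℂ (Submodule.pi Set.univ
        (fun _ : Fin 3 => homogeneousSubmodule (Fin 3) ℂ k)) :=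
      Module.Finite.iff_fg.2 (Submodule.fg_pi fun _ => homogeneousSubmodule_fg _ _ k)
    exact Submodule.finiteDimensional_of_le inf_le_right
  rw [arDim, Module.finrank_pos_iff, Submodule.nontrivial_iff_ne_bot, Submodule.ne_bot_iff]

/-- `hlow` concerns arbitrary relations, so the vectors produced by Hilbert–Burch need not be
homogeneous. -/
lemma mdr_eq_two {f : S} {a : Fin 3 → S} (ha : ∑ i, grad f i * a i = 0)
    (ha2 : ∀ i, (a i).IsHomogeneous 2) (ha0 : a ≠ 0)
    (hlow : ∀ b : Fin 3 → S, ∑ i, grad f i * b i = 0 →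
      ∀ i, ∀ m : Fin 3 →₀ ℕ, m.degree < 2 → coeff m (b i) = 0) : mdr f = 2 := by
  refine le_antisymm (Nat.sInf_le (arDim_pos_iff.2
    ⟨a, mem_jacobianRelationsPiece.2 ⟨ha, ha2⟩, ha0⟩))
    (le_csInf ⟨2, arDim_pos_iff.2 ⟨a, mem_jacobianRelationsPiece.2 ⟨ha, ha2⟩, ha0⟩⟩ ?_)
  intro k hk
  obtain ⟨b, hb, hb0⟩ := arDim_pos_iff.1 hk
  obtain ⟨hb, hbk⟩ := mem_jacobianRelationsPiece.1 hb
  by_contra! hk2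
  refine hb0 (funext fun i => MvPolynomial.ext _ _ fun m => ?_)
  rw [Pi.zero_apply, coeff_zero]
  by_cases hm : m.degree = k
  · exact hlow b hb i m (hm ▸ hk2)
  · exact (hbk i).coeff_eq_zero hm

lemma coeff_mul_eq_zero_of_degree_lt {a b : S} {k l : ℕ}
    (ha : ∀ m : Fin 3 →₀ ℕ, m.degree < k → coeff m a = 0) (hb : b.IsHomogeneous l)
    {m : Fin 3 →₀ ℕ} (hm : m.degree < k + l) : coeff m (a * b) = 0 := by
  classical
  rw [coeff_mul]
  refine Finset.sum_eq_zero fun x hx => ?_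
  by_cases h : x.2.degree = l
  · have hx' : x.1.degree + x.2.degree = m.degree := by
      rw [← Finset.HasAntidiagonal.mem_antidiagonal.1 hx, map_add]
    rw [ha _ (by omega), zero_mul]
  · rw [hb.coeff_eq_zero h, mul_zero]

lemma coeff_mulVec_eq_zero_of_degree_lt {m n k l : ℕ} {M : Matrix (Fin m) (Fin n) S} {i : Fin m}
    (hM : ∀ j, (M i j).IsHomogeneous l) {b : Fin n → S}
    (hb : ∀ j, ∀ m : Fin 3 →₀ ℕ, m.degree < k → coeff m (b j) = 0)
    {m : Fin 3 →₀ ℕ} (hm : m.degree < k + l) : coeff m (M.mulVec b i) = 0 := by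
  rw [Matrix.mulVec, dotProduct, coeff_sum]
  refine Finset.sum_eq_zero fun j _ => ?_
  rw [mul_comm]
  exact coeff_mul_eq_zero_of_degree_lt (hb j) (hM j) hm

end JacobianRelations

/-! ### Criteria for free and nearly free curves -/

section HilbertBurchCriteria

/-- Saito's criterion for two quadratic Jacobian relations. -/
theorem saturation_eq_and_mdr_eq_two {f : S} {M : Matrix (Fin 3) (Fin 2) S} {u : Fin 3 → S}
    (hM2 : ∀ i l, (M i l).IsHomogeneous 2) (hM : ∀ i, rowMinor M i = u i * grad f i)
    (hu : ∀ i, IsUnit (u i)) (hD : ∀ l, ∑ i, grad f i * M i l = 0)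
    (hgcd : ∀ g, (∀ i, g ∣ grad f i) → IsUnit g)
    {P : Fin 3 → ℂ} {i j k : Fin 3} (hijk : ∀ m, m = i ∨ m = j ∨ m = k) (hji : j ≠ i)
    (hjk : j ≠ k) (hPi : P i = 0) (hPk : P k = 1) {r : Fin 3} (hr : eval P (grad f r) ≠ 0) :
    saturation (jacobianIdeal f) = jacobianIdeal f ∧ mdr f = 2 := by
  refine ⟨saturation_span_eq hM hu hD hgcd hijk hji hjk hPi hPk hr,
    mdr_eq_two (a := fun i => M i 0) (hD 0) (fun i => hM2 i 0) ?_ ?_⟩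
  · intro h0
    have : rowMinor M r = 0 := by
      refine Matrix.det_eq_zero_of_column_eq_zero 0 fun s => congrFun h0 _
    rw [hM] at this
    rcases mul_eq_zero.1 this with h | h
    · exact (hu r).ne_zero h
    · exact hr (by rw [h, map_zero])
  · intro b hb i m hm
    obtain ⟨c, rfl⟩ := exists_mulVec_eq hM hu hD hgcd hb
    -- With k = 0 nothing is asked of c: the quadratic entries alone give order 2.
    exact coeff_mulVec_eq_zero_of_degree_lt (k := 0) (hM2 i) (fun _ _ h => absurd h (by simp))
      (by omega)

variable {f h : S} {M : Matrix (Fin 4) (Fin 3) S} {u : Fin 4 → S}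

/-- The derivative of the sum in direction l, taken at the origin, is the constant term of `b l`. -/
lemma eval_zero_eq_zero_of_sum_X_mul_eq_zero {b : Fin 3 → S} (hb : ∑ l, X l * b l = 0)
    (l : Fin 3) : eval 0 (b l) = 0 := by
  have := congrArg (fun p => eval 0 (pderiv l p)) hb
  simpa [Pi.single_apply, pderiv_X, apply_ite] using this

/-- A criterion for nearly free curves: four cubics, the partial derivatives and one further
form `h`, are the maximal minors of a matrix of linear forms with last row `(x, y, z)`. -/
theorem nu_eq_one_and_mdr_eq_two (hM1 : ∀ i l, (M i l).IsHomogeneous 1)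
    (hlast : ∀ l, M (Fin.last 3) l = X l) (hh : h.IsHomogeneous 3)
    (hM : ∀ i, rowMinor M i = u i * (Fin.snoc (grad f) h : Fin 4 → S) i)
    (hu : ∀ i, IsUnit (u i))
    (hD : ∀ l, ∑ i, (Fin.snoc (grad f) h : Fin 4 → S) i * M i l = 0)
    (hgcd : ∀ g, (∀ i, g ∣ grad f i) → IsUnit g)
    {P : Fin 3 → ℂ} {i j k : Fin 3} (hijk : ∀ m, m = i ∨ m = j ∨ m = k) (hji : j ≠ i)
    (hjk : j ≠ k) (hPi : P i = 0) (hPk : P k = 1) {r : Fin 3} (hr : eval P (grad f r) ≠ 0) :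
    nu f = 1 ∧ mdr f = 2 := by
  set D : Fin 4 → S := Fin.snoc (grad f) h with hDdef
  have hDc : ∀ i : Fin 3, D i.castSucc = grad f i := fun i => by simp [hDdef]
  have hDl : D (Fin.last 3) = h := Fin.snoc_last _ _
  have hgcd' : ∀ g, (∀ i, g ∣ D i) → IsUnit g := fun g hg =>
    hgcd g fun i => hDc i ▸ hg i.castSucc
  -- The last row of M reads off the coefficient of h.
  have hsyz : ∀ (a : Fin 3 → S) (e : S), ∑ i, grad f i * a i + h * e = 0 →
      ∃ b, (∀ i : Fin 3, M.mulVec b i.castSucc = a i) ∧ ∑ l, X l * b l = e := by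
    intro a e hae
    obtain ⟨b, hb⟩ := exists_mulVec_eq hM hu hD hgcd' (a := Fin.snoc a e)
      (by rw [Fin.sum_univ_castSucc]; simpa [hDc, hDl, -Fin.reduceLast] using hae)
    refine ⟨b, fun i => by simp [hb], ?_⟩
    have := congrFun hb (Fin.last 3)
    simpa [Matrix.mulVec, dotProduct, hlast, -Fin.reduceLast] using this
  have hXh : ∀ l, X l * h ∈ jacobianIdeal f := by
    intro l
    have := hD l
    rw [Fin.sum_univ_castSucc] at this
    simp only [hDc, hDl, hlast] at this
    refine (Ideal.mem_span_range_iff_exists_fun).2 ⟨fun i => - M i.castSucc l, ?_⟩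
    rw [mul_comm, ← sub_eq_zero, ← neg_eq_zero, ← this, neg_sub, sub_eq_add_neg, add_comm,
      ← Finset.sum_neg_distrib]
    simp [mul_comm]
  have hmh : ∀ a ∈ irrelevantIdeal, a * h ∈ jacobianIdeal f := by
    intro a ha
    refine Submodule.span_induction (p := fun a _ => a * h ∈ jacobianIdeal f) ?_ (by simp)
      (fun x y _ _ hx hy => by rw [add_mul]; exact add_mem hx hy)
      (fun c x _ hx => by rw [smul_eq_mul, mul_assoc]; exact Ideal.mul_mem_left _ _ hx) ha
    rintro _ ⟨l, rfl⟩
    exact hXh l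
  -- (J_f, h) is saturated, and only the constant term of the coefficient of h matters because 𝔪h ⊆
  -- J_f.
  have hsat : ∀ g ∈ saturation (jacobianIdeal f), ∃ c : ℂ, g - C c * h ∈ jacobianIdeal f := by
    intro g hg
    have hle : jacobianIdeal f ≤ Ideal.span (Set.range D) := Ideal.span_mono <| by
      rintro _ ⟨i, rfl⟩
      exact ⟨i.castSucc, hDc i⟩
    have hg' := saturation_mono hle hg
    rw [saturation_span_eq hM hu hD hgcd' hijk hji hjk hPi hPk (r := r.castSucc)
      (by rwa [hDc])] at hg'
    obtain ⟨a, ha⟩ := (Ideal.mem_span_range_iff_exists_fun).1 hg'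
    rw [Fin.sum_univ_castSucc] at ha
    simp only [hDc, hDl] at ha
    refine ⟨eval 0 (a (Fin.last 3)), ?_⟩
    rw [← ha, add_sub_assoc, ← sub_mul]
    exact add_mem ((Ideal.mem_span_range_iff_exists_fun).2 ⟨_, rfl⟩)
      (hmh _ (sub_C_mem_irrelevantIdeal _))
  -- Otherwise -1 would be a combination of x, y, z.
  have hhJ : h ∉ jacobianIdeal f := by
    intro hmem
    obtain ⟨a, ha⟩ := (Ideal.mem_span_range_iff_exists_fun).1 hmem
    obtain ⟨b, -, hb⟩ := hsyz a (-1) (by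
      rw [← ha, mul_neg_one, ← sub_eq_add_neg, sub_eq_zero]
      exact Finset.sum_congr rfl fun _ _ => mul_comm _ _)
    have := congrArg (eval 0) hb
    simp at this
  have hhsat : h ∈ saturation (jacobianIdeal f) := ⟨1, fun a ha => hmh a (by simpa using ha)⟩
  let π := Ideal.Quotient.mkₐ ℂ (jacobianIdeal f)
  have hπh : π h ≠ 0 := fun h0 => hhJ (Ideal.Quotient.eq_zero_iff_mem.1 h0)
  have hpiece : ∀ j, jacobianModulePiece f j ≤ ℂ ∙ π h := by
    rintro j _ ⟨g, ⟨hg, -⟩, rfl⟩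
    obtain ⟨c, hc⟩ := hsat g hg
    refine Submodule.mem_span_singleton.2 ⟨c, ?_⟩
    have : π g = π (C c * h) := Ideal.Quotient.eq.2 hc
    rw [← map_smul, smul_eq_C_mul]
    exact this.symm
  refine ⟨le_antisymm (iSup_le fun j => ?_) ?_, ?_⟩
  · have := Submodule.finrank_mono (hpiece j)
    rw [finrank_span_singleton hπh] at this
    exact_mod_cast this
  · refine le_iSup_of_le 3 ?_
    have : jacobianModulePiece f 3 = ℂ ∙ π h := by
      refine le_antisymm (hpiece 3) ?_
      rw [Submodule.span_singleton_le_iff_mem]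
      exact ⟨h, ⟨hhsat, hh⟩, rfl⟩
    rw [nDim, this, finrank_span_singleton hπh, Nat.cast_one]
  · have hrow : ∀ b : Fin 3 → S, ∑ l, X l * b l = 0 →
        ∑ i, grad f i * M.mulVec b (Fin.castSucc i) = 0 := by
      intro b hb
      have h1 : ∑ i, D i * M.mulVec b i = 0 := by
        simp only [Matrix.mulVec, dotProduct, Finset.mul_sum]
        rw [Finset.sum_comm]
        refine Finset.sum_eq_zero fun l _ => ?_
        simp only [← mul_assoc]
        rw [← Finset.sum_mul, hD, zero_mul]
      rw [Fin.sum_univ_castSucc] at h1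
      have h2 : M.mulVec b (Fin.last 3) = 0 := by
        simpa [Matrix.mulVec, dotProduct, hlast, -Fin.reduceLast] using hb
      simpa [hDc, h2, -Fin.reduceLast] using h1
    -- A Koszul relation of (x, y, z) supplies the nonzero relation of degree 2.
    have hb0 : ∑ l, X l * (![X 1, -X 0, 0] : Fin 3 → S) l = 0 := by
      simp [Fin.sum_univ_three]; ring
    refine mdr_eq_two (a := fun i => M.mulVec ![X 1, -X 0, 0] i.castSucc) (hrow _ hb0) ?_ ?_ ?_
    · intro i
      have hv : ∀ l, ((![X 1, -X 0, 0] : Fin 3 → S) l).IsHomogeneous 1 := by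
        simp only [Fin.forall_fin_succ, IsEmpty.forall_iff, and_true]
        exact ⟨isHomogeneous_X _ _, (isHomogeneous_X _ _).neg, isHomogeneous_zero _ _ _⟩
      exact IsHomogeneous.sum _ _ _ fun l _ => (hM1 _ l).mul (hv l)
    · intro h0
      have h1 : ∀ j, M.mulVec ![X 1, -X 0, 0] j = 0 := by
        refine Fin.lastCases ?_ (fun j => congrFun h0 j)
        simpa [Matrix.mulVec, dotProduct, hlast, -Fin.reduceLast] using hb0
      have hr' : rowMinor M r.castSucc ≠ 0 := by
        rw [hM, hDc]
        exact mul_ne_zero (hu _).ne_zero fun h => hr (by rw [h, map_zero])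
      have := map_eq_zero_of_map_mulVec_eq_zero M (RingHom.id S) hr' h1 0
      exact X_ne_zero (R := ℂ) (1 : Fin 3) this
    · intro a ha i m hm
      obtain ⟨b, hb, hbe⟩ := hsyz a 0 (by simpa using ha)
      rw [← hb]
      refine coeff_mulVec_eq_zero_of_degree_lt (k := 1) (hM1 _) (fun l m hm => ?_) hm
      have : m = 0 := by rw [← Finsupp.degree_eq_zero_iff]; omega
      rw [this, ← constantCoeff_eq, ← eval_zero]
      exact eval_zero_eq_zero_of_sum_X_mul_eq_zero hbe l

end HilbertBurchCriteria

/-! ### Zero sets and parametrized curves -/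

section ZeroSets

lemma eval_smul_of_isHomogeneous {f : S} {d : ℕ} (hf : f.IsHomogeneous d) (c : ℂ)
    (v : Fin 3 → ℂ) : eval (c • v) f = c ^ d * eval v f := by
  rw [eval_eq, eval_eq, Finset.mul_sum]
  refine Finset.sum_congr rfl fun m hm => ?_
  have hd : ∑ i ∈ m.support, m i = d := by
    by_contra h
    exact mem_support_iff.1 hm (hf.coeff_eq_zero (by rwa [Finsupp.degree_apply]))
  simp only [Pi.smul_apply, smul_eq_mul, mul_pow, Finset.prod_mul_distrib,
    Finset.prod_pow_eq_pow_sum, hd]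
  ring

lemma mk_mem_zeroSet_iff {f : S} {d : ℕ} (hf : f.IsHomogeneous d) {v : Fin 3 → ℂ} (hv : v ≠ 0) :
    Projectivization.mk ℂ v hv ∈ zeroSet f ↔ eval v f = 0 := by
  obtain ⟨a, ha⟩ := Projectivization.exists_smul_eq_mk_rep ℂ v hv
  rw [zeroSet, Set.mem_ofPred_eq, ← ha, Units.smul_def, eval_smul_of_isHomogeneous hf]
  simp

lemma zeroSet_eq_parametrized {f : S} {d : ℕ} (hf : f.IsHomogeneous d)
    {φ : ℂ → ℂ → Fin 3 → ℂ} (hφ : ∀ s t, eval (φ s t) f = 0)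
    (hv : ∀ v : Fin 3 → ℂ, v ≠ 0 → eval v f = 0 → ∃ s t c : ℂ, c ≠ 0 ∧ φ s t = c • v) :
    zeroSet f = parametrized φ := by
  ext p
  induction p using Projectivization.ind with | _ v hv0
  rw [mk_mem_zeroSet_iff hf]
  constructor
  · intro h
    obtain ⟨s, t, c, hc, hst⟩ := hv v hv0 h
    have h0 : φ s t ≠ 0 := hst ▸ smul_ne_zero hc hv0
    exact ⟨s, t, h0, ((Projectivization.mk_eq_mk_iff' ℂ _ _ h0 hv0).2 ⟨c, hst.symm⟩).symm⟩
  · rintro ⟨s, t, h0, h⟩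
    rw [← mk_mem_zeroSet_iff hf hv0, h, mk_mem_zeroSet_iff hf]
    exact hφ s t

/-- The chart version of `zeroSet_eq_parametrized`: it suffices to reach the points at which the
first coordinate is `0` or `1`. -/
lemma zeroSet_eq_parametrized_of_chart {f : S} {d : ℕ} (hf : f.IsHomogeneous d)
    {φ : ℂ → ℂ → Fin 3 → ℂ} (hφ : ∀ s t, eval (φ s t) f = 0)
    (h1 : ∀ y z, eval ![1, y, z] f = 0 → ∃ s t c : ℂ, c ≠ 0 ∧ φ s t = c • ![1, y, z])
    (h0 : ∀ y z, ![0, y, z] ≠ (0 : Fin 3 → ℂ) → eval ![0, y, z] f = 0 →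
      ∃ s t c : ℂ, c ≠ 0 ∧ φ s t = c • ![0, y, z]) :
    zeroSet f = parametrized φ := by
  refine zeroSet_eq_parametrized hf hφ fun v hv hfv => ?_
  have hv3 : v = ![v 0, v 1, v 2] := by ext i; fin_cases i <;> rfl
  by_cases hx : v 0 = 0
  · rw [hx] at hv3
    rw [hv3] at hv hfv ⊢
    exact h0 _ _ hv hfv
  · have hv1 : ![1, v 1 / v 0, v 2 / v 0] = (v 0)⁻¹ • v := by
      ext i; fin_cases i <;> simp [hx, div_eq_inv_mul]
    obtain ⟨s, t, c, hc, hst⟩ := h1 (v 1 / v 0) (v 2 / v 0) (by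
      rw [hv1, eval_smul_of_isHomogeneous hf, hfv, mul_zero])
    exact ⟨s, t, c * (v 0)⁻¹, mul_ne_zero hc (inv_ne_zero hx), by rw [hst, hv1, smul_smul]⟩

lemma image_map_parametrized (e : (Fin 3 → ℂ) ≃ₗ[ℂ] (Fin 3 → ℂ)) (φ : ℂ → ℂ → Fin 3 → ℂ) :
    Projectivization.map e.toLinearMap e.injective '' parametrized φ =
      parametrized fun s t => e (φ s t) := by
  ext p
  constructor
  · rintro ⟨_, ⟨s, t, h, rfl⟩, rfl⟩
    exact ⟨s, t, by simpa using h, Projectivization.map_mk _ _ _ _⟩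
  · rintro ⟨s, t, h, rfl⟩
    have h' : φ s t ≠ 0 := by simpa using h
    exact ⟨_, ⟨s, t, h', rfl⟩, Projectivization.map_mk _ _ _ _⟩

end ZeroSets

/-! ### Elimination of a quadratic or cubic parameter -/

section Roots

/-- The norm form of `A t` over the roots of `t² - p t + q` vanishes at `w` only if `w = A t` for
one of the roots. -/
lemma exists_root_quadratic {A p q w : ℂ} (h : w ^ 2 - A * p * w + A ^ 2 * q = 0) :
    ∃ t, t ^ 2 - p * t + q = 0 ∧ w = A * t := by
  obtain ⟨r, hr⟩ := IsAlgClosed.exists_pow_nat_eq (p ^ 2 - 4 * q) (n := 2) two_pos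
  have : (w - A * ((p + r) / 2)) * (w - A * ((p - r) / 2)) = 0 := by
    linear_combination h - A ^ 2 / 4 * hr
  rcases mul_eq_zero.1 this with h | h
  · exact ⟨_, by linear_combination hr / 4, sub_eq_zero.1 h⟩
  · exact ⟨_, by linear_combination hr / 4, sub_eq_zero.1 h⟩

/-- The norm form of `A t² + B t` over the roots of `t³ + p t - q` vanishes at `w` only if
`w = A t² + B t` for one of the roots. -/
lemma exists_root_cubic {A B p q w : ℂ}
    (h : w ^ 3 + 2 * p * A * w ^ 2 + (B ^ 2 * p - 3 * A * B * q + A ^ 2 * p ^ 2) * w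
      - q * (B ^ 3 + A ^ 2 * B * p + A ^ 3 * q) = 0) :
    ∃ t, t ^ 3 + p * t - q = 0 ∧ w = A * t ^ 2 + B * t := by
  obtain ⟨a, ha⟩ : ∃ a : ℂ, a ^ 3 + p * a - q = 0 := by
    obtain ⟨a, ha⟩ := IsAlgClosed.exists_root
      (Polynomial.X ^ 3 + Polynomial.C p * Polynomial.X - Polynomial.C q) (by
        have : (Polynomial.X ^ 3 + Polynomial.C p * Polynomial.X - Polynomial.C q).degree = 3 := by
          compute_degree!
        rw [this]; decide)
    exact ⟨a, by simpa [Polynomial.IsRoot] using ha⟩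
  -- The discriminant of t² + a t + a² + p, whose roots b and -a - b complete the root set; written
  -- in a and b, the norm form factors.
  obtain ⟨r, hr⟩ := IsAlgClosed.exists_pow_nat_eq (-3 * a ^ 2 - 4 * p) (n := 2) two_pos
  obtain ⟨b, hb⟩ : ∃ b, b = (-a + r) / 2 := ⟨_, rfl⟩
  have hp : p = -(a ^ 2 + a * b + b ^ 2) := by rw [hb]; linear_combination hr / 4
  have hq : q = -a * b * (a + b) := by rw [hp] at ha; linear_combination - ha
  subst hp hq
  have : (w - (A * a ^ 2 + B * a)) * (w - (A * b ^ 2 + B * b)) *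
      (w - (A * (-a - b) ^ 2 + B * (-a - b))) = 0 := by
    linear_combination h
  rcases mul_eq_zero.1 this with h | h
  · rcases mul_eq_zero.1 h with h | h
    · exact ⟨_, by ring, sub_eq_zero.1 h⟩
    · exact ⟨_, by ring, sub_eq_zero.1 h⟩
  · exact ⟨_, by ring, sub_eq_zero.1 h⟩

end Roots

/-! ### Numerals as constant polynomials -/

section ExplicitPolynomials

lemma isUnit_ofNat (n : ℕ) [n.AtLeastTwo] : IsUnit (OfNat.ofNat n : S) := by
  rw [← map_ofNat (C : ℂ →+* S)]
  exact (isUnit_iff_ne_zero.2 (OfNat.ofNat_ne_zero n)).map C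

lemma isUnit_polynomial_ofNat (n : ℕ) [n.AtLeastTwo] :
    IsUnit (OfNat.ofNat n : Polynomial ℂ) := by
  rw [← map_ofNat (Polynomial.C : ℂ →+* Polynomial ℂ)]
  exact (isUnit_iff_ne_zero.2 (OfNat.ofNat_ne_zero n)).map Polynomial.C

lemma isHomogeneous_ofNat (n : ℕ) [n.AtLeastTwo] : (OfNat.ofNat n : S).IsHomogeneous 0 := by
  rw [← map_ofNat (C : ℂ →+* S)]
  exact isHomogeneous_C _ _

lemma isHomogeneous_mul {p q : S} {a b d : ℕ} (hp : p.IsHomogeneous a) (hq : q.IsHomogeneous b)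
    (h : a + b = d) : (p * q).IsHomogeneous d := h ▸ hp.mul hq

lemma pderiv_ofNat (i : Fin 3) (n : ℕ) [n.AtLeastTwo] :
    pderiv i (ofNat(n) : S) = 0 := by
  rw [← map_ofNat (C : ℂ →+* S), pderiv_C]

lemma forall_fin_three {p : Fin 3 → Prop} : (∀ i, p i) ↔ p 0 ∧ p 1 ∧ p 2 := by
  simp [Fin.forall_fin_succ]

end ExplicitPolynomials

/-! ### The quintic 𝒞₅ -/

section Quintic

lemma isHomogeneous_quinticEq : quinticEq.IsHomogeneous 5 := by
  unfold quinticEq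
  repeat' first
    | exact isHomogeneous_X _ _ | exact isHomogeneous_X_pow _ _ | exact isHomogeneous_ofNat _
    | apply IsHomogeneous.add | apply IsHomogeneous.sub | apply IsHomogeneous.neg
    | apply isHomogeneous_mul | rfl

lemma grad_quinticEq : grad quinticEq =
    ![48 * X 0 ^ 2 * X 2 ^ 2 - 48 * X 0 * X 1 ^ 2 * X 2 + 9 * X 1 ^ 4 + 48 * X 1 ^ 3 * X 2,
      -48 * X 0 ^ 2 * X 1 * X 2 + 36 * X 0 * X 1 ^ 3 + 144 * X 0 * X 1 ^ 2 * X 2 - 20 * X 1 ^ 4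
        - 64 * X 1 ^ 3 * X 2,
      32 * X 0 ^ 3 * X 2 - 24 * X 0 ^ 2 * X 1 ^ 2 + 48 * X 0 * X 1 ^ 3 - 16 * X 1 ^ 4] := by
  rw [funext_iff, forall_fin_three]
  refine ⟨?_, ?_, ?_⟩ <;>
  simp [grad, quinticEq, pderiv_X, pderiv_ofNat, Derivation.leibniz_pow] <;> ring

/-- Two quadratic Jacobian relations of the quintic. -/
noncomputable def quinticRelations : Matrix (Fin 3) (Fin 2) S :=
  !![-600 * X 0 ^ 2 - 240 * X 0 * X 1 - 512 * X 0 * X 2 + 400 * X 1 ^ 2,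
      40 * X 0 ^ 2 - 32 * X 0 * X 1;
    -240 * X 0 * X 2 + 360 * X 1 ^ 2 - 192 * X 1 * X 2, -12 * X 1 ^ 2;
    900 * X 0 * X 2 - 225 * X 1 ^ 2 + 768 * X 2 ^ 2,
      -60 * X 0 * X 2 + 15 * X 1 ^ 2 + 48 * X 1 * X 2]

lemma isUnit_of_forall_dvd_grad_quinticEq {g : S} (hg : ∀ i, g ∣ grad quinticEq i) :
    IsUnit g := by
  -- `v` is a Bézout certificate: the restricted partials combine to the constant 1920.
  refine isUnit_of_forall_dvd (l := ![Polynomial.X, -1, Polynomial.X - 1])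
    (v := ![-44 * Polynomial.X + 20, 9, 66 * Polynomial.X - 96]) (i := 0) (d := 4)
    ?_ ?_ (isHomogeneous_quinticEq.pderiv).totalDegree_le ?_ hg
  · rw [forall_fin_three]
    refine ⟨?_, ?_, ?_⟩ <;> (simp; try compute_degree)
  · convert isUnit_polynomial_ofNat 1920 using 1
    simp [Fin.sum_univ_three, grad_quinticEq]
    ring
  · rw [show (aeval ![Polynomial.X, -1, Polynomial.X - 1] (grad quinticEq 0) : Polynomial ℂ) =
      48 * Polynomial.X ^ 4 - 96 * Polynomial.X ^ 3 + 57 by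
        simp [grad_quinticEq]; ring]
    simp

lemma saturation_quinticEq_and_mdr :
    saturation (jacobianIdeal quinticEq) = jacobianIdeal quinticEq ∧ mdr quinticEq = 2 := by
  refine saturation_eq_and_mdr_eq_two (M := quinticRelations) (u := ![300, -300, 300])
    (P := ![0, 1, 0]) (i := 0) (j := 2) (k := 1) (r := 1) ?_ ?_ ?_ ?_
    (fun _ => isUnit_of_forall_dvd_grad_quinticEq) (by decide) (by decide) (by decide) rfl rfl ?_
  · simp only [quinticRelations, forall_fin_three, Fin.forall_fin_two]
    simp
    refine ⟨⟨?_, ?_⟩, ⟨?_, ?_⟩, ⟨?_, ?_⟩⟩ <;>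
    repeat' first
    | exact isHomogeneous_X _ _ | exact isHomogeneous_X_pow _ _ | exact isHomogeneous_ofNat _
    | apply IsHomogeneous.add | apply IsHomogeneous.sub | apply IsHomogeneous.neg
    | apply isHomogeneous_mul | rfl
  · rw [forall_fin_three]
    refine ⟨?_, ?_, ?_⟩ <;>
    simp [rowMinor, quinticRelations, grad_quinticEq, Matrix.det_fin_two, Fin.succAbove] <;> ring
  · rw [forall_fin_three]
    exact ⟨isUnit_ofNat _, (isUnit_ofNat _).neg, isUnit_ofNat _⟩
  · rw [Fin.forall_fin_two]
    refine ⟨?_, ?_⟩ <;>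
    simp [Fin.sum_univ_three, quinticRelations, grad_quinticEq] <;> ring
  · simp [grad_quinticEq]

lemma zeroSet_quinticEq : zeroSet quinticEq = quintic := by
  refine zeroSet_eq_parametrized_of_chart isHomogeneous_quinticEq ?_ ?_ ?_
  · intro s t
    simp [quinticEq]
    ring
  · intro y z h
    simp [quinticEq] at h
    -- With s = 1, y = t² / (t - 1/2) gives the quadratic for t; reducing z modulo it leaves A t
    -- plus a polynomial in y.
    obtain ⟨t, ht, hz⟩ := exists_root_quadratic (A := y ^ 3 - 2 * y ^ 2) (p := y) (q := y / 2)
      (w := z + y ^ 3 / 2 - 3 / 4 * y ^ 2) (by linear_combination h / 16)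
    refine ⟨1, t, t - 1 / 2, fun h0 => ?_, ?_⟩
    · rw [sub_eq_zero.1 h0] at ht
      exact absurd ht (by ring_nf; norm_num)
    · have hz' : z = (y ^ 3 - 2 * y ^ 2) * t - y ^ 3 / 2 + 3 / 4 * y ^ 2 := by
        linear_combination hz
      ext i
      fin_cases i
      · simp
      · simp
        linear_combination ht
      · simp [hz']
        linear_combination (t ^ 3 + t ^ 2 * y - 3/2 * t ^ 2 + t * y ^ 2 - 2 * t * y
          - 1/2 * y ^ 2 + 3/4 * y) * ht
  · intro y z hv h
    simp [quinticEq] at h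
    by_cases hy : y = 0
    · have hz : z ≠ 0 := by rintro rfl; simp [hy] at hv
      refine ⟨0, 1, z⁻¹, inv_ne_zero hz, ?_⟩
      ext i
      fin_cases i <;> simp [hy, hz]
    -- On x = 0 the parameter has s = 0 or t = s/2; this is the second point.
    · refine ⟨1, 1 / 2, 1 / 4 / y, by simp [hy], ?_⟩
      have hz : z = -y / 4 := by
        refine mul_left_cancel₀ (pow_ne_zero 4 hy) ?_
        linear_combination - h / 16
      ext i
      fin_cases i
      · simp
      · simp [hy]; norm_num
      · simp [hz]; field_simp; norm_num

lemma isReducedEquation_quintic : IsReducedEquation quintic 5 quinticEq :=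
  ⟨isHomogeneous_quinticEq,
    squarefree_of_forall_dvd_grad fun _ => isUnit_of_forall_dvd_grad_quinticEq, zeroSet_quinticEq⟩

theorem isFreeWithExponents_quintic : IsFreeWithExponents quintic 2 2 :=
  ⟨5, quinticEq, isReducedEquation_quintic, saturation_quinticEq_and_mdr.1,
    saturation_quinticEq_and_mdr.2, rfl⟩

end Quintic

/-! ### The quintic 𝒞₅' -/

section QuinticThreeA4

/-- A reduced equation of the quintic with three cusps of type `A₄`. -/
noncomputable def quinticEq' : S :=
  -709375 * X 0 ^ 5 - 4800000 * X 0 ^ 4 * X 1 + 3360000 * X 0 ^ 4 * X 2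
    - 54560000 * X 0 ^ 3 * X 1 ^ 2 + 17664000 * X 0 ^ 3 * X 1 * X 2
    - 4915200 * X 0 ^ 3 * X 2 ^ 2 + 199424000 * X 0 ^ 2 * X 1 ^ 3
    - 18022400 * X 0 ^ 2 * X 1 ^ 2 * X 2 + 3932160 * X 0 ^ 2 * X 1 * X 2 ^ 2
    + 1048576 * X 0 ^ 2 * X 2 ^ 3 - 265420800 * X 0 * X 1 ^ 4
    - 49807360 * X 0 * X 1 ^ 3 * X 2 - 2097152 * X 0 * X 1 ^ 2 * X 2 ^ 2
    + 8126464 * X 1 ^ 5 + 1048576 * X 1 ^ 4 * X 2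

lemma isHomogeneous_quinticEq' : quinticEq'.IsHomogeneous 5 := by
  unfold quinticEq'
  repeat' first
    | exact isHomogeneous_X _ _ | exact isHomogeneous_X_pow _ _ | exact isHomogeneous_ofNat _
    | apply IsHomogeneous.add | apply IsHomogeneous.sub | apply IsHomogeneous.neg
    | apply isHomogeneous_mul | rfl

lemma grad_quinticEq' : grad quinticEq' =
    ![-3546875 * X 0 ^ 4 - 19200000 * X 0 ^ 3 * X 1 + 13440000 * X 0 ^ 3 * X 2
        - 163680000 * X 0 ^ 2 * X 1 ^ 2 + 52992000 * X 0 ^ 2 * X 1 * X 2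
        - 14745600 * X 0 ^ 2 * X 2 ^ 2 + 398848000 * X 0 * X 1 ^ 3
        - 36044800 * X 0 * X 1 ^ 2 * X 2 + 7864320 * X 0 * X 1 * X 2 ^ 2
        + 2097152 * X 0 * X 2 ^ 3 - 265420800 * X 1 ^ 4 - 49807360 * X 1 ^ 3 * X 2
        - 2097152 * X 1 ^ 2 * X 2 ^ 2,
      -4800000 * X 0 ^ 4 - 109120000 * X 0 ^ 3 * X 1 + 17664000 * X 0 ^ 3 * X 2
        + 598272000 * X 0 ^ 2 * X 1 ^ 2 - 36044800 * X 0 ^ 2 * X 1 * X 2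
        + 3932160 * X 0 ^ 2 * X 2 ^ 2 - 1061683200 * X 0 * X 1 ^ 3
        - 149422080 * X 0 * X 1 ^ 2 * X 2 - 4194304 * X 0 * X 1 * X 2 ^ 2
        + 40632320 * X 1 ^ 4 + 4194304 * X 1 ^ 3 * X 2,
      3360000 * X 0 ^ 4 + 17664000 * X 0 ^ 3 * X 1 - 9830400 * X 0 ^ 3 * X 2
        - 18022400 * X 0 ^ 2 * X 1 ^ 2 + 7864320 * X 0 ^ 2 * X 1 * X 2
        + 3145728 * X 0 ^ 2 * X 2 ^ 2 - 49807360 * X 0 * X 1 ^ 3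
        - 4194304 * X 0 * X 1 ^ 2 * X 2 + 1048576 * X 1 ^ 4] := by
  rw [funext_iff, forall_fin_three]
  refine ⟨?_, ?_, ?_⟩ <;>
  simp [grad, quinticEq', pderiv_X, pderiv_ofNat, Derivation.leibniz_pow] <;> ring

/-- Two quadratic Jacobian relations of the quintic with three cusps of type `A₄`. -/
noncomputable def quinticRelations' : Matrix (Fin 3) (Fin 2) S :=
  !![3840 * X 0 ^ 2 - 2048 * X 0 * X 1,
      -172800 * X 0 ^ 2 - 40960 * X 0 * X 1 - 24576 * X 0 * X 2 + 8192 * X 1 ^ 2;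
    400 * X 0 ^ 2 - 2560 * X 0 * X 1 + 512 * X 0 * X 2 - 512 * X 1 ^ 2,
      -14500 * X 0 ^ 2 + 121600 * X 0 * X 1 - 35840 * X 0 * X 2 + 97280 * X 1 ^ 2;
    4625 * X 0 ^ 2 + 4800 * X 0 * X 1 - 3200 * X 0 * X 2 + 19840 * X 1 ^ 2 + 2048 * X 1 * X 2,
      -203125 * X 0 ^ 2 - 260000 * X 0 * X 1 + 96000 * X 0 * X 2 - 1696000 * X 1 ^ 2
        + 16384 * X 2 ^ 2]

lemma isUnit_of_forall_dvd_grad_quinticEq' {g : S} (hg : ∀ i, g ∣ grad quinticEq' i) :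
    IsUnit g := by
  refine isUnit_of_forall_dvd (l := ![-1, Polynomial.X, 0])
    (v := ![-133265739776 * Polynomial.X - 2179408431840,
      -1205315217472 * Polynomial.X + 30145461740,
      12973074296240 * Polynomial.X + 639297469075]) (i := 2) (d := 4)
    ?_ ?_ (isHomogeneous_quinticEq'.pderiv).totalDegree_le ?_ hg
  · rw [forall_fin_three]
    refine ⟨?_, ?_, ?_⟩ <;> simp
  · convert isUnit_polynomial_ofNat 9733430561422500000 using 1
    simp [Fin.sum_univ_three, grad_quinticEq']
    ring
  · rw [show (aeval ![-1, Polynomial.X, 0] (grad quinticEq' 2) : Polynomial ℂ) =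
      1048576 * Polynomial.X ^ 4 + 49807360 * Polynomial.X ^ 3 - 18022400 * Polynomial.X ^ 2
        - 17664000 * Polynomial.X + 3360000 by
        simp [grad_quinticEq']; ring]
    simp [Polynomial.coeff_X]

lemma saturation_quinticEq'_and_mdr :
    saturation (jacobianIdeal quinticEq') = jacobianIdeal quinticEq' ∧ mdr quinticEq' = 2 := by
  refine saturation_eq_and_mdr_eq_two (M := quinticRelations') (u := ![4, -4, 4])
    (P := ![1, 0, 0]) (i := 1) (j := 2) (k := 0) (r := 0) ?_ ?_ ?_ ?_
    (fun _ => isUnit_of_forall_dvd_grad_quinticEq') (by decide) (by decide) (by decide) rfl rfl ?_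
  · simp only [quinticRelations', forall_fin_three, Fin.forall_fin_two]
    simp
    refine ⟨⟨?_, ?_⟩, ⟨?_, ?_⟩, ⟨?_, ?_⟩⟩ <;>
    repeat' first
    | exact isHomogeneous_X _ _ | exact isHomogeneous_X_pow _ _ | exact isHomogeneous_ofNat _
    | apply IsHomogeneous.add | apply IsHomogeneous.sub | apply IsHomogeneous.neg
    | apply isHomogeneous_mul | rfl
  · rw [forall_fin_three]
    refine ⟨?_, ?_, ?_⟩ <;>
    simp [rowMinor, quinticRelations', grad_quinticEq', Matrix.det_fin_two, Fin.succAbove] <;>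
    ring
  · rw [forall_fin_three]
    exact ⟨isUnit_ofNat _, (isUnit_ofNat _).neg, isUnit_ofNat _⟩
  · rw [Fin.forall_fin_two]
    refine ⟨?_, ?_⟩ <;>
    simp [Fin.sum_univ_three, quinticRelations', grad_quinticEq'] <;> ring
  · simp [grad_quinticEq']

lemma zeroSet_quinticEq' : zeroSet quinticEq' = quintic' := by
  refine zeroSet_eq_parametrized_of_chart isHomogeneous_quinticEq' ?_ ?_ ?_
  · intro s t
    simp [quinticEq']
    ring
  · intro y z h
    simp [quinticEq'] at h
    -- With s = 1, y (t - 1) = t³ - 5/32 is the cubic for t. Dividing by 1048576 makes the equation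
    -- monic in z, so that it is the norm form.
    obtain ⟨t, ht, hz⟩ := exists_root_cubic (A := y + 15 / 4) (B := -5 * y + 75 / 32) (p := -y)
      (q := 5 / 32 - y) (w := z + 15 / 4 * y - 25 / 16) (by linear_combination h / 1048576)
    refine ⟨1, t, t - 1, fun h0 => ?_, ?_⟩
    · rw [sub_eq_zero.1 h0] at ht
      exact absurd ht (by ring_nf; norm_num)
    · have hz' : z = (y + 15 / 4) * t ^ 2 + (-5 * y + 75 / 32) * t - 15 / 4 * y + 25 / 16 := by
        linear_combination hz
      ext i
      fin_cases i
      · simp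
      · simp
        linear_combination ht
      · simp [hz']
        linear_combination (t ^ 2 - 5 * t - 15 / 4) * ht
  · intro y z hv h
    simp [quinticEq'] at h
    by_cases hy : y = 0
    · have hz : z ≠ 0 := by rintro rfl; simp [hy] at hv
      refine ⟨0, 1, z⁻¹, inv_ne_zero hz, ?_⟩
      ext i
      fin_cases i <;> simp [hy, hz]
    · refine ⟨1, 1, 27 / 32 / y, by simp [hy], ?_⟩
      have hz : z = -(31 / 4) * y := by
        refine mul_left_cancel₀ (pow_ne_zero 4 hy) ?_
        linear_combination h / 1048576
      ext i
      fin_cases i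
      · simp
      · simp [hy]; norm_num
      · simp [hz]; field_simp; norm_num

theorem isFreeWithExponents_quintic' : IsFreeWithExponents quintic' 2 2 :=
  ⟨5, quinticEq', ⟨isHomogeneous_quinticEq',
    squarefree_of_forall_dvd_grad fun _ => isUnit_of_forall_dvd_grad_quinticEq',
    zeroSet_quinticEq'⟩, saturation_quinticEq'_and_mdr.1, saturation_quinticEq'_and_mdr.2, rfl⟩

end QuinticThreeA4

/-! ### The quintic 𝒞₅'' -/

section QuinticA6

lemma isHomogeneous_quinticEq'' : quinticEq''.IsHomogeneous 5 := by
  unfold quinticEq''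
  repeat' first
    | exact isHomogeneous_X _ _ | exact isHomogeneous_X_pow _ _ | exact isHomogeneous_ofNat _
    | apply IsHomogeneous.add | apply IsHomogeneous.sub | apply IsHomogeneous.neg
    | apply isHomogeneous_mul | rfl

lemma grad_quinticEq'' : grad quinticEq'' =
    ![-135 * X 0 ^ 4 - 54 * X 0 ^ 2 * X 1 * X 2 + 4 * X 0 * X 1 ^ 3 + 2 * X 0 * X 2 ^ 3
        - 2 * X 1 ^ 2 * X 2 ^ 2,
      -18 * X 0 ^ 3 * X 2 + 6 * X 0 ^ 2 * X 1 ^ 2 - 4 * X 0 * X 1 * X 2 ^ 2 + 4 * X 1 ^ 3 * X 2,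
      -18 * X 0 ^ 3 * X 1 + 3 * X 0 ^ 2 * X 2 ^ 2 - 4 * X 0 * X 1 ^ 2 * X 2 + X 1 ^ 4] := by
  rw [funext_iff, forall_fin_three]
  refine ⟨?_, ?_, ?_⟩ <;>
  simp [grad, quinticEq'', pderiv_X, pderiv_ofNat, Derivation.leibniz_pow] <;> ring

/-- Two quadratic Jacobian relations of the quintic with cusps of types `A₆, A₂, A₂, A₂`. -/
noncomputable def quinticRelations'' : Matrix (Fin 3) (Fin 2) S :=
  !![-12 * X 0 * X 1, -42 * X 0 * X 2 + 30 * X 1 ^ 2;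
    15 * X 0 * X 2 - 7 * X 1 ^ 2, 315 * X 0 ^ 2 + 8 * X 1 * X 2;
    90 * X 0 ^ 2 + 28 * X 1 * X 2, -120 * X 0 * X 1 + 28 * X 2 ^ 2]

lemma isUnit_of_forall_dvd_grad_quinticEq'' {g : S} (hg : ∀ i, g ∣ grad quinticEq'' i) :
    IsUnit g := by
  refine isUnit_of_forall_dvd (l := ![Polynomial.X, -1, 0])
    (v := ![0, -3 * Polynomial.X, 1]) (i := 0) (d := 4)
    ?_ ?_ (isHomogeneous_quinticEq''.pderiv).totalDegree_le ?_ hg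
  · rw [forall_fin_three]
    refine ⟨?_, ?_, ?_⟩ <;> simp
  · convert isUnit_one using 1
    simp [Fin.sum_univ_three, grad_quinticEq'']
    ring
  · rw [show (aeval ![Polynomial.X, -1, 0] (grad quinticEq'' 0) : Polynomial ℂ) =
      -135 * Polynomial.X ^ 4 - 4 * Polynomial.X by
        simp [grad_quinticEq'']; ring]
    simp [Polynomial.coeff_X]

lemma saturation_quinticEq''_and_mdr :
    saturation (jacobianIdeal quinticEq'') = jacobianIdeal quinticEq'' ∧ mdr quinticEq'' = 2 := by
  refine saturation_eq_and_mdr_eq_two (M := quinticRelations'') (u := ![210, -210, 210])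
    (P := ![1, 0, 0]) (i := 1) (j := 2) (k := 0) (r := 0) ?_ ?_ ?_ ?_
    (fun _ => isUnit_of_forall_dvd_grad_quinticEq'') (by decide) (by decide) (by decide) rfl rfl ?_
  · simp only [quinticRelations'', forall_fin_three, Fin.forall_fin_two]
    simp
    refine ⟨⟨?_, ?_⟩, ⟨?_, ?_⟩, ⟨?_, ?_⟩⟩ <;>
    repeat' first
    | exact isHomogeneous_X _ _ | exact isHomogeneous_X_pow _ _ | exact isHomogeneous_ofNat _
    | apply IsHomogeneous.add | apply IsHomogeneous.sub | apply IsHomogeneous.neg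
    | apply isHomogeneous_mul | rfl
  · rw [forall_fin_three]
    refine ⟨?_, ?_, ?_⟩ <;>
    simp [rowMinor, quinticRelations'', grad_quinticEq'', Matrix.det_fin_two, Fin.succAbove] <;>
    ring
  · rw [forall_fin_three]
    exact ⟨isUnit_ofNat _, (isUnit_ofNat _).neg, isUnit_ofNat _⟩
  · rw [Fin.forall_fin_two]
    refine ⟨?_, ?_⟩ <;>
    simp [Fin.sum_univ_three, quinticRelations'', grad_quinticEq''] <;> ring
  · simp [grad_quinticEq'']

lemma zeroSet_quinticEq'' : zeroSet quinticEq'' = quintic'' := by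
  refine zeroSet_eq_parametrized_of_chart isHomogeneous_quinticEq'' ?_ ?_ ?_
  · intro s t
    simp [quinticEq'']
    ring
  · intro y z h
    simp [quinticEq''] at h
    -- With s = 1, y t = t³ - 1, and z = t⁴ + 2t reduces to y t² + 3t.
    obtain ⟨t, ht, hz⟩ := exists_root_cubic (A := y) (B := 3) (p := -y) (q := 1) (w := z)
      (by linear_combination h)
    refine ⟨1, t, t, fun h0 => ?_, ?_⟩
    · simp [h0] at ht
    · ext i
      fin_cases i
      · simp
      · simp
        linear_combination ht
      · simp [hz]
        linear_combination t ^ 2 * ht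
  · intro y z hv h
    simp [quinticEq''] at h
    by_cases hy : y = 0
    · have hz : z ≠ 0 := by rintro rfl; simp [hy] at hv
      refine ⟨0, 1, z⁻¹, inv_ne_zero hz, ?_⟩
      ext i
      fin_cases i <;> simp [hy, hz]
    · have hz : z = 0 := by simpa [hy] using h
      refine ⟨1, 0, -y⁻¹, by simp [hy], ?_⟩
      ext i
      fin_cases i <;> simp [hy, hz]

lemma isReducedEquation_quintic'' : IsReducedEquation quintic'' 5 quinticEq'' :=
  ⟨isHomogeneous_quinticEq'',
    squarefree_of_forall_dvd_grad fun _ => isUnit_of_forall_dvd_grad_quinticEq'',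
    zeroSet_quinticEq''⟩

theorem isFreeWithExponents_quintic'' : IsFreeWithExponents quintic'' 2 2 :=
  ⟨5, quinticEq'', isReducedEquation_quintic'', saturation_quinticEq''_and_mdr.1,
    saturation_quinticEq''_and_mdr.2, rfl⟩

end QuinticA6

/-! ### The symmetric equation of the quartic -/

section QuarticEq

lemma isHomogeneous_quarticEq : quarticEq.IsHomogeneous 4 := by
  unfold quarticEq
  repeat' first
    | exact isHomogeneous_X _ _ | exact isHomogeneous_X_pow _ _ | exact isHomogeneous_ofNat _
    | apply IsHomogeneous.add | apply IsHomogeneous.sub | apply IsHomogeneous.neg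
    | apply isHomogeneous_mul | rfl

lemma grad_quarticEq : grad quarticEq =
    ![2 * X 0 * X 1 ^ 2 - 4 * X 0 * X 1 * X 2 + 2 * X 0 * X 2 ^ 2 - 2 * X 1 ^ 2 * X 2
        - 2 * X 1 * X 2 ^ 2,
      2 * X 0 ^ 2 * X 1 - 2 * X 0 ^ 2 * X 2 - 4 * X 0 * X 1 * X 2 - 2 * X 0 * X 2 ^ 2
        + 2 * X 1 * X 2 ^ 2,
      -2 * X 0 ^ 2 * X 1 + 2 * X 0 ^ 2 * X 2 - 2 * X 0 * X 1 ^ 2 - 4 * X 0 * X 1 * X 2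
        + 2 * X 1 ^ 2 * X 2] := by
  rw [funext_iff, forall_fin_three]
  refine ⟨?_, ?_, ?_⟩ <;>
  simp [grad, quarticEq, pderiv_X, pderiv_ofNat, Derivation.leibniz_pow] <;> ring

/-- The linear syzygies of the partial derivatives of `quarticEq` and one further cubic. -/
noncomputable def quarticSyzygies : Matrix (Fin 4) (Fin 3) S :=
  !![-X 0, 3 * X 0 - 2 * X 1, -3 * X 0;
    2 * X 0 - 3 * X 1, X 1, 3 * X 1;
    -X 0 + 3 * X 2, X 1 - 3 * X 2, 0;
    X 0, X 1, X 2]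

lemma isUnit_of_forall_dvd_grad_quarticEq {g : S} (hg : ∀ i, g ∣ grad quarticEq i) :
    IsUnit g := by
  refine isUnit_of_forall_dvd (l := ![-1, Polynomial.X, Polynomial.X - 1])
    (v := ![0, -Polynomial.X - 1, Polynomial.X]) (i := 0) (d := 3)
    ?_ ?_ (isHomogeneous_quarticEq.pderiv).totalDegree_le ?_ hg
  · rw [forall_fin_three]
    refine ⟨?_, ?_, ?_⟩ <;> (simp; try compute_degree)
  · convert (isUnit_polynomial_ofNat 4).neg using 1
    simp [Fin.sum_univ_three, grad_quarticEq]
    ring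
  · rw [show (aeval ![-1, Polynomial.X, Polynomial.X - 1] (grad quarticEq 0) : Polynomial ℂ) =
      -4 * Polynomial.X ^ 3 + 6 * Polynomial.X ^ 2 - 2 * Polynomial.X - 2 by
        simp [grad_quarticEq]; ring]
    simp [Polynomial.coeff_X]

lemma nu_quarticEq_and_mdr : nu quarticEq = 1 ∧ mdr quarticEq = 2 := by
  refine nu_eq_one_and_mdr_eq_two (M := quarticSyzygies) (u := ![-3, 3, -3, 3])
    (h := -6 * X 0 ^ 2 * X 1 + 6 * X 0 ^ 2 * X 2 + 6 * X 0 * X 1 ^ 2 - 6 * X 1 ^ 2 * X 2)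
    (P := ![0, 1, 1]) (i := 0) (j := 1) (k := 2) (r := 0) ?_ ?_ ?_ ?_ ?_ ?_
    (fun _ => isUnit_of_forall_dvd_grad_quarticEq) (by decide) (by decide) (by decide) rfl rfl ?_
  · simp only [quarticSyzygies, Fin.forall_fin_succ, IsEmpty.forall_iff]
    simp
    repeat' first
    | exact isHomogeneous_X _ _ | exact isHomogeneous_X_pow _ _ | exact isHomogeneous_ofNat _
    | exact isHomogeneous_zero _ _ _
    | apply IsHomogeneous.add | apply IsHomogeneous.sub | apply IsHomogeneous.neg
    | apply isHomogeneous_mul | rfl | apply And.intro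
  · rw [forall_fin_three]
    exact ⟨rfl, rfl, rfl⟩
  · repeat' first
    | exact isHomogeneous_X _ _ | exact isHomogeneous_X_pow _ _ | exact isHomogeneous_ofNat _
    | apply IsHomogeneous.add | apply IsHomogeneous.sub | apply IsHomogeneous.neg
    | apply isHomogeneous_mul | rfl
  · rw [Fin.forall_fin_succ', forall_fin_three]
    refine ⟨⟨?_, ?_, ?_⟩, ?_⟩ <;>
    simp only [Fin.snoc_last, Fin.snoc_castSucc, grad_quarticEq, rowMinor, Matrix.det_fin_three] <;>
    simp [quarticSyzygies, Fin.succAbove] <;> ring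
  · rw [Fin.forall_fin_succ', forall_fin_three]
    exact ⟨⟨(isUnit_ofNat _).neg, isUnit_ofNat _, (isUnit_ofNat _).neg⟩, isUnit_ofNat _⟩
  · rw [forall_fin_three]
    simp only [Fin.sum_univ_castSucc (n := 3), Fin.snoc_last, Fin.snoc_castSucc,
      Fin.sum_univ_three, grad_quarticEq]
    refine ⟨?_, ?_, ?_⟩ <;>
    simp [quarticSyzygies] <;> ring
  · simp [grad_quarticEq]
    norm_num

/-- In a = xy, b = yz, c = xz the equation is a² + b² + c² = 2(ab + bc + ca), that is ±√a ± √b ± √c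
= 0. Taking s² = a, t² = b, (t - s)² = c, the parametrization yields xyz · (x, y, z). -/
lemma zeroSet_quarticEq : zeroSet quarticEq = parametrized fun s t =>
    ![s ^ 2 * (t - s) ^ 2, s ^ 2 * t ^ 2, t ^ 2 * (t - s) ^ 2] := by
  refine zeroSet_eq_parametrized isHomogeneous_quarticEq ?_ fun v hv h => ?_
  · intro s t
    simp [quarticEq]
    ring
  obtain ⟨x, y, z, rfl⟩ : ∃ x y z, v = ![x, y, z] :=
    ⟨v 0, v 1, v 2, by ext i; fin_cases i <;> rfl⟩
  simp [quarticEq] at h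
  by_cases hx : x = 0
  · subst hx
    have hyz : y = 0 ∨ z = 0 := by simpa using h
    by_cases hy : y = 0
    · subst hy
      have hz : z ≠ 0 := by rintro rfl; simp at hv
      refine ⟨0, 1, z⁻¹, inv_ne_zero hz, ?_⟩
      ext i; fin_cases i <;> simp [hz]
    · have hz := hyz.resolve_left hy
      refine ⟨1, 1, y⁻¹, inv_ne_zero hy, ?_⟩
      ext i; fin_cases i <;> simp [hy, hz]
  by_cases hyz : y * z = 0
  · have h0 : y = 0 ∧ z = 0 := by
      rcases mul_eq_zero.1 hyz with hy | hz
      · exact ⟨hy, by simpa [hy, hx] using h⟩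
      · exact ⟨by simpa [hz, hx] using h, hz⟩
    refine ⟨1, 0, x⁻¹, inv_ne_zero hx, ?_⟩
    ext i; fin_cases i <;> simp [hx, h0]
  obtain ⟨s, hs⟩ := IsAlgClosed.exists_pow_nat_eq (x * y) (n := 2) two_pos
  obtain ⟨t, ht, hst⟩ : ∃ t, t ^ 2 = y * z ∧ (t - s) ^ 2 = x * z := by
    obtain ⟨t, ht⟩ := IsAlgClosed.exists_pow_nat_eq (y * z) (n := 2) two_pos
    -- The sign of t must be chosen so that 2st = xy + yz - xz.
    have : (x * y + y * z - x * z - 2 * s * t) * (x * y + y * z - x * z + 2 * s * t) = 0 := by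
      linear_combination h - 4 * t ^ 2 * hs - 4 * x * y * ht
    rcases mul_eq_zero.1 this with h1 | h1
    · exact ⟨t, ht, by linear_combination hs + ht + h1⟩
    · exact ⟨-t, by rw [neg_sq, ht], by linear_combination hs + ht + h1⟩
  refine ⟨s, t, x * (y * z), mul_ne_zero hx hyz, ?_⟩
  ext i
  fin_cases i <;> simp [hs, ht, hst] <;> ring

lemma isReducedEquation_quarticEq : IsReducedEquation (zeroSet quarticEq) 4 quarticEq :=
  ⟨isHomogeneous_quarticEq,
    squarefree_of_forall_dvd_grad fun _ => isUnit_of_forall_dvd_grad_quarticEq, rfl⟩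

theorem isNearlyFreeWithExponents_quarticEq :
    IsNearlyFreeWithExponents (zeroSet quarticEq) 2 2 :=
  ⟨4, quarticEq, isReducedEquation_quarticEq, nu_quarticEq_and_mdr.1, nu_quarticEq_and_mdr.2, rfl⟩

end QuarticEq

/-! ### The quartic 𝒞₄ in its given coordinates -/

section TricuspidalQuartic

/-- The equation of the tricuspidal quartic in the coordinates of its parametrization. -/
noncomputable def tricuspidalEq : S :=
  4 * X 0 ^ 2 * X 2 ^ 2 + 8 * X 0 * X 1 ^ 3 + 12 * X 0 * X 1 ^ 2 * X 2 - 3 * X 1 ^ 4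
    - 4 * X 1 ^ 3 * X 2

/-- The change of coordinates `(x, y, z) ↦ (y - 2x, y, y + z)`. -/
noncomputable def quarticCoordinates : (Fin 3 → ℂ) ≃ₗ[ℂ] (Fin 3 → ℂ) where
  toFun v := ![v 1 - 2 * v 0, v 1, v 1 + v 2]
  invFun v := ![(v 1 - v 0) / 2, v 1, v 2 - v 1]
  map_add' v w := by ext i; fin_cases i <;> simp <;> ring
  map_smul' c v := by ext i; fin_cases i <;> simp <;> ring
  left_inv v := by ext i; fin_cases i <;> simp
  right_inv v := by ext i; fin_cases i <;> simp; ring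

lemma isHomogeneous_tricuspidalEq : tricuspidalEq.IsHomogeneous 4 := by
  unfold tricuspidalEq
  repeat' first
    | exact isHomogeneous_X _ _ | exact isHomogeneous_X_pow _ _ | exact isHomogeneous_ofNat _
    | apply IsHomogeneous.add | apply IsHomogeneous.sub | apply IsHomogeneous.neg
    | apply isHomogeneous_mul | rfl

lemma grad_tricuspidalEq : grad tricuspidalEq =
    ![8 * X 0 * X 2 ^ 2 + 8 * X 1 ^ 3 + 12 * X 1 ^ 2 * X 2,
      24 * X 0 * X 1 ^ 2 + 24 * X 0 * X 1 * X 2 - 12 * X 1 ^ 3 - 12 * X 1 ^ 2 * X 2,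
      8 * X 0 ^ 2 * X 2 + 12 * X 0 * X 1 ^ 2 - 4 * X 1 ^ 3] := by
  rw [funext_iff, forall_fin_three]
  refine ⟨?_, ?_, ?_⟩ <;>
  simp [grad, tricuspidalEq, pderiv_X, pderiv_ofNat, Derivation.leibniz_pow] <;> ring

/-- The linear syzygies of the partial derivatives of `tricuspidalEq` and one further cubic. -/
noncomputable def tricuspidalSyzygies : Matrix (Fin 4) (Fin 3) S :=
  !![12 * X 0, 12 * X 0, -24 * X 0 + 12 * X 1;
    8 * X 0 + 4 * X 1, 4 * X 1, 8 * X 1;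
    -24 * X 0 - 12 * X 1 - 12 * X 2, -24 * X 1 - 12 * X 2, 0;
    X 0, X 1, X 2]

lemma isUnit_of_forall_dvd_grad_tricuspidalEq {g : S} (hg : ∀ i, g ∣ grad tricuspidalEq i) :
    IsUnit g := by
  refine isUnit_of_forall_dvd (l := ![Polynomial.X, -1, Polynomial.X])
    (v := ![-1, 0, 1]) (i := 0) (d := 3)
    ?_ ?_ (isHomogeneous_tricuspidalEq.pderiv).totalDegree_le ?_ hg
  · rw [forall_fin_three]
    refine ⟨?_, ?_, ?_⟩ <;> simp
  · convert isUnit_polynomial_ofNat 12 using 1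
    simp [Fin.sum_univ_three, grad_tricuspidalEq]
    ring
  · rw [show (aeval ![Polynomial.X, -1, Polynomial.X] (grad tricuspidalEq 0) : Polynomial ℂ) =
      8 * Polynomial.X ^ 3 + 12 * Polynomial.X - 8 by
        simp [grad_tricuspidalEq]; ring]
    simp [Polynomial.coeff_X]

/-- The criterion is applied to this equation directly, so no invariance of ν and mdr under
coordinate changes is needed. -/
lemma nu_tricuspidalEq_and_mdr : nu tricuspidalEq = 1 ∧ mdr tricuspidalEq = 2 := by
  refine nu_eq_one_and_mdr_eq_two (M := tricuspidalSyzygies) (u := ![-12, 12, -12, 12])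
    (h := 192 * X 0 ^ 2 * X 2 + 96 * X 0 * X 1 ^ 2 - 96 * X 0 * X 1 * X 2 - 48 * X 1 ^ 3)
    (P := ![0, 1, 0]) (i := 0) (j := 2) (k := 1) (r := 0) ?_ ?_ ?_ ?_ ?_ ?_
    (fun _ => isUnit_of_forall_dvd_grad_tricuspidalEq) (by decide) (by decide) (by decide)
    rfl rfl ?_
  · simp only [tricuspidalSyzygies, Fin.forall_fin_succ, IsEmpty.forall_iff]
    simp
    repeat' first
    | exact isHomogeneous_X _ _ | exact isHomogeneous_X_pow _ _ | exact isHomogeneous_ofNat _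
    | exact isHomogeneous_zero _ _ _
    | apply IsHomogeneous.add | apply IsHomogeneous.sub | apply IsHomogeneous.neg
    | apply isHomogeneous_mul | rfl | apply And.intro
  · rw [forall_fin_three]
    exact ⟨rfl, rfl, rfl⟩
  · repeat' first
    | exact isHomogeneous_X _ _ | exact isHomogeneous_X_pow _ _ | exact isHomogeneous_ofNat _
    | apply IsHomogeneous.add | apply IsHomogeneous.sub | apply IsHomogeneous.neg
    | apply isHomogeneous_mul | rfl
  · rw [Fin.forall_fin_succ', forall_fin_three]
    refine ⟨⟨?_, ?_, ?_⟩, ?_⟩ <;>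
    simp only [Fin.snoc_last, Fin.snoc_castSucc, grad_tricuspidalEq, rowMinor,
      Matrix.det_fin_three] <;>
    simp [tricuspidalSyzygies, Fin.succAbove] <;> ring
  · rw [Fin.forall_fin_succ', forall_fin_three]
    exact ⟨⟨(isUnit_ofNat _).neg, isUnit_ofNat _, (isUnit_ofNat _).neg⟩, isUnit_ofNat _⟩
  · rw [forall_fin_three]
    simp only [Fin.sum_univ_castSucc (n := 3), Fin.snoc_last, Fin.snoc_castSucc,
      Fin.sum_univ_three, grad_tricuspidalEq]
    refine ⟨?_, ?_, ?_⟩ <;>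
    simp [tricuspidalSyzygies] <;> ring
  · simp [grad_tricuspidalEq]

lemma image_quartic :
    Projectivization.map quarticCoordinates.toLinearMap quarticCoordinates.injective '' quartic =
      zeroSet quarticEq := by
  rw [quartic, image_map_parametrized, zeroSet_quarticEq]
  congr 1
  ext s t i
  fin_cases i <;> simp [quarticCoordinates] <;> ring

/-- `tricuspidalEq` is the pullback of `quarticEq` along `quarticCoordinates`, so this is the
preimage of `image_quartic`. -/
lemma zeroSet_tricuspidalEq : zeroSet tricuspidalEq = quartic := by
  have he := Projectivization.map_injective quarticCoordinates.toLinearMap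
    quarticCoordinates.injective
  rw [← Set.preimage_image_eq quartic he, image_quartic]
  ext p
  induction p using Projectivization.ind with | _ v hv
  rw [Set.mem_preimage, Projectivization.map_mk, mk_mem_zeroSet_iff isHomogeneous_tricuspidalEq,
    mk_mem_zeroSet_iff isHomogeneous_quarticEq]
  have : eval (quarticCoordinates v) quarticEq = eval v tricuspidalEq := by
    simp [quarticCoordinates, quarticEq, tricuspidalEq]
    ring
  rw [← this]
  rfl

theorem isNearlyFreeWithExponents_quartic : IsNearlyFreeWithExponents quartic 2 2 :=
  ⟨4, tricuspidalEq, ⟨isHomogeneous_tricuspidalEq,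
    squarefree_of_forall_dvd_grad fun _ => isUnit_of_forall_dvd_grad_tricuspidalEq,
    zeroSet_tricuspidalEq⟩, nu_tricuspidalEq_and_mdr.1, nu_tricuspidalEq_and_mdr.2, rfl⟩

end TricuspidalQuartic

end PlaneCurve

theorem corollary4p2 :
    -- the quartic, its equation in suitable coordinates, and the curve with that equation
    (PlaneCurve.IsNearlyFreeWithExponents PlaneCurve.quartic 2 2 ∧
      ∃ C : Set PlaneCurve.P2,
        PlaneCurve.ProjectivelyEquivalent PlaneCurve.quartic C ∧
        PlaneCurve.IsReducedEquation C 4 PlaneCurve.quarticEq ∧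
        PlaneCurve.IsNearlyFreeWithExponents C 2 2) ∧
    -- the three quintics
    PlaneCurve.IsFreeWithExponents PlaneCurve.quintic 2 2 ∧
    PlaneCurve.IsFreeWithExponents PlaneCurve.quintic' 2 2 ∧
    PlaneCurve.IsFreeWithExponents PlaneCurve.quintic'' 2 2 ∧
    -- the equations of two of the quintics
    PlaneCurve.IsReducedEquation PlaneCurve.quintic 5 PlaneCurve.quinticEq ∧
    PlaneCurve.IsReducedEquation PlaneCurve.quintic'' 5 PlaneCurve.quinticEq'' :=
  ⟨⟨PlaneCurve.isNearlyFreeWithExponents_quartic, PlaneCurve.zeroSet PlaneCurve.quarticEq,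
      ⟨PlaneCurve.quarticCoordinates, PlaneCurve.image_quartic⟩,
      PlaneCurve.isReducedEquation_quarticEq, PlaneCurve.isNearlyFreeWithExponents_quarticEq⟩,
    PlaneCurve.isFreeWithExponents_quintic, PlaneCurve.isFreeWithExponents_quintic',
    PlaneCurve.isFreeWithExponents_quintic'', PlaneCurve.isReducedEquation_quintic,
    PlaneCurve.isReducedEquation_quintic''⟩
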